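/- **Definitions.** Let $g\ge 1$ be an integer, and let $n=2g+1$ or $n=2g+2$. For a prime $p$ and a monic integer polynomial $f$ of degree $n$ with $p^2\mid\Delta(f)$, say that $p^2$ *strongly divides* $\Delta(f)$ if $p^2\mid\Delta(f+ph)$ for every integer polynomial $h$ of degree $n$, and that $p^2$ *weakly divides* $\Delta(f)$ otherwise. For a squarefree positive integer $m$, let $\mathcal W_m^{(2)}$ be the set of monic integer polynomials $f$ of degree $n$ such that $p^2$ weakly divides $\Delta(f)$ for every prime $p\mid m$. Let $A_0$ be the $n\times n$ matrix with $1$'s on the anti-diagonal and $0$'s elsewhere. For a symmetric $n\times n$ rational matrix $B$, put $f_B(x)=(-1)^{n(n-1)/2}\det(A_0x-B)$ and $\Delta(B)=\Delta(f_B)$. Let $W_0$ be the space of symmetric $n\times n$ matrices whose top left $g\times(n-g-1)$ block is zero, and for a positive integer $d$ let $\frac1dW_0(\mathbb Z)$ be the set of $B\in W_0(\mathbb Q)$ such that $dB$ has integer entries. For a prime $p$ and $B\in\frac1dW_0(\mathbb Z)$, say that $p^2$ *strongly divides* $\Delta(B)$ on $\frac1dW_0(\mathbb Z)$ if $p^2$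 divides $\Delta(B)$ and $\Delta(B+pB')$ in $\mathbb Z_{(p)}$ for all $B'\in\frac1dW_0(\mathbb Z)$. For a pair $(A,B)$ of $g\times(g+1)$ matrices, let $M_i(x,y)$ ($1\le i\le g+1$) be $(-1)^{i-1}$ times the determinant of the matrix obtained from $Ax-By$ by deleting the $i$-th column; it is a binary form of degree $g$. Let $Q(A,B)$ be the determinant of the $(g+1)\times(g+1)$ matrix whose $i$-th row consists of the coefficients of $M_i$ at $x^ky^{g-k}$, $k=0,\dots,g$. For $B\in W_0(\mathbb Q)$ put $Q(B)=Q(A_0^{\mathrm{top}},B^{\mathrm{top}})$, where the superscript denotes the top right $g\times(g+1)$ block. For integers $c_1,\dots,c_n$, let $B_m(c_1,\dots,c_n)$ be the symmetric $n\times n$ matrix whose entries $(i,j)$ with $i\le j$ are zero except for the following: * the entry $(1,n-1)$ is $m$, and the entries $(i,n-i)$ with $2\le i\le n/2$ are $1$; * if $n=2g+1$: the entry $(g+1+k,g+1+k)$ is $-c_{2k+1}$ for $0\le k\le g$, and the entry $(g+1+k,g+2+k)$ is $-c_{2k+2}/2$ for $0\le k\le g-1$; * if $n=2g+2$: the entry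 $(g+2,g+2)$ is $c_1^2/4-c_2$, the entry $(g+2+k,g+2+k)$ is $-c_{2k+2}$ for $1\le k\le g$, and the entry $(g+1+k,g+2+k)$ is $-c_{2k+1}/2$ for $0\le k\le g$. **Theorem.** Let $g\ge1$, let $n=2g+1$ or $n=2g+2$, and let $m$ be a positive squarefree integer. Put $d=2$ if $n$ is odd and $d=4$ if $n$ is even. There is a map $\sigma_m:\mathcal W_m^{(2)}\to\frac1dW_0(\mathbb Z)$ such that for every $f\in\mathcal W_m^{(2)}$: 1. there are integers $\ell,c_1,\dots,c_n$ with $f(x+\ell)=x^n+c_1x^{n-1}+\cdots+c_{n-2}x^2+mc_{n-1}x+m^2c_n$ and $\sigma_m(f)=B_m(c_1,\dots,c_n)+\ell A_0$; 2. $f_{\sigma_m(f)}=f$; 3. $p^2$ strongly divides $\Delta(\sigma_m(f))$ on $\frac1dW_0(\mathbb Z)$ for every prime $p\mid m$; 4. $|Q(\sigma_m(f))|=m$. -/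

import Mathlib

open Polynomial

noncomputable section

namespace SquarefreeDisc

/-! ### Discriminants of integer polynomials -/

/-- `p ^ 2` strongly divides the discriminant of `f`: it divides the discriminant of `f + p g`
for every integer polynomial `g` of the same degree as `f`. -/
def StronglyDvdDisc (p : ℕ) (f : ℤ[X]) : Prop :=
  (p : ℤ) ^ 2 ∣ f.discr ∧
    ∀ h : ℤ[X], h.natDegree = f.natDegree → (p : ℤ) ^ 2 ∣ (f + C (p : ℤ) * h).discr

/-- `p ^ 2` weakly divides the discriminant of `f`: it divides it, but not strongly. -/
def WeaklyDvdDisc (p : ℕ) (f : ℤ[X]) : Prop :=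
  (p : ℤ) ^ 2 ∣ f.discr ∧ ¬ StronglyDvdDisc p f

/-- The monic integer polynomials of degree `n` whose discriminant is weakly divisible by `p ^ 2`
for every prime factor `p` of `m`. -/
def weakSet (n m : ℕ) : Set ℤ[X] :=
  {f | f.Monic ∧ f.natDegree = n ∧ ∀ p : ℕ, p.Prime → p ∣ m → WeaklyDvdDisc p f}

/-! ### Symmetric matrices and their invariant polynomials -/

/-- The `n × n` matrix with ones on the anti-diagonal and zeros elsewhere. -/
def antiDiag (n : ℕ) : Matrix (Fin n) (Fin n) ℚ :=
  Matrix.of fun i j => if i.val + j.val + 1 = n then 1 else 0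

/-- The invariant polynomial `f_B(x) = (-1)^{n(n-1)/2} det (A₀ x - B)`. -/
def invPoly {n : ℕ} (B : Matrix (Fin n) (Fin n) ℚ) : ℚ[X] :=
  (-1) ^ (n * (n - 1) / 2) * ((X : ℚ[X]) • (antiDiag n).map C - B.map C).det

/-- The discriminant of a matrix is the discriminant of its invariant polynomial. -/
def matDisc {n : ℕ} (B : Matrix (Fin n) (Fin n) ℚ) : ℚ := (invPoly B).discr

/-- The space `W₀(ℚ)`: symmetric `n × n` matrices whose top left `g × (n - (g + 1))` block
vanishes. This block is `g × g` for `n = 2 g + 1` and `g × (g + 1)` for `n = 2 g + 2`. -/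
def W0 (g n : ℕ) : Set (Matrix (Fin n) (Fin n) ℚ) :=
  {B | B.IsSymm ∧ ∀ i j : Fin n, i.val < g → j.val + (g + 1) < n → B i j = 0}

/-- The lattice `(1/d) W₀(ℤ)`: elements `B` of `W₀(ℚ)` such that `d B` has integer entries. -/
def W0Lattice (g n d : ℕ) : Set (Matrix (Fin n) (Fin n) ℚ) :=
  {B | B ∈ W0 g n ∧ ∀ i j : Fin n, ∃ z : ℤ, (d : ℚ) * B i j = z}

/-- Divisibility of a rational number by `p ^ 2` in the local ring `ℤ_(p)`: the number equals
`p ^ 2 * a / b` with integers `a`, `b` and `b` prime to `p`. -/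
def SqDvdAt (p : ℕ) (r : ℚ) : Prop :=
  ∃ a b : ℤ, ¬ (p : ℤ) ∣ b ∧ (b : ℚ) * r = (p : ℚ) ^ 2 * a

/-- `p ^ 2` strongly divides the discriminant of `B`, viewed as an element of the lattice `L`:
it divides the discriminant of `B + p B'` for every `B'` in `L`. -/
def StronglyDvdMatDisc {n : ℕ} (L : Set (Matrix (Fin n) (Fin n) ℚ)) (p : ℕ)
    (B : Matrix (Fin n) (Fin n) ℚ) : Prop :=
  SqDvdAt p (matDisc B) ∧ ∀ B' ∈ L, SqDvdAt p (matDisc (B + (p : ℚ) • B'))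

/-! ### The `Q`-invariant -/

/-- The `i`-th entry of the vector `M_v(x, y)` of signed `g × g` minors of `A x - B y`, for the
pair `v = (A, B)` of `g × (g + 1)` matrices. This is a binary form of degree `g`, written here in
the dehomogenized form `y = 1`: the coefficient of `x ^ k y ^ (g - k)` is the coefficient of
`X ^ k`. -/
def signedMinor {g : ℕ} (A B : Matrix (Fin g) (Fin (g + 1)) ℚ) (i : Fin (g + 1)) : ℚ[X] :=
  (-1) ^ i.val * (((X : ℚ[X]) • A.map C - B.map C).submatrix id i.succAbove).det

/-- The `Q`-invariant of a pair of `g × (g + 1)` matrices: the determinant of the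
`(g + 1) × (g + 1)` matrix of coefficients of the `g + 1` binary forms of degree `g` above. -/
def pairQ {g : ℕ} (A B : Matrix (Fin g) (Fin (g + 1)) ℚ) : ℚ :=
  (Matrix.of fun i k : Fin (g + 1) => (signedMinor A B i).coeff k.val).det

/-- The top right `g × (g + 1)` block of an `n × n` matrix. -/
def topRight {n : ℕ} (g : ℕ) (hn : g + 1 ≤ n) (B : Matrix (Fin n) (Fin n) ℚ) :
    Matrix (Fin g) (Fin (g + 1)) ℚ :=
  Matrix.of fun i j => B ⟨i.val, by omega⟩ ⟨n - (g + 1) + j.val, by omega⟩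

/-- The `Q`-invariant of an element `B` of `W₀`. -/
def matQ {n : ℕ} (g : ℕ) (hn : g + 1 ≤ n) (B : Matrix (Fin n) (Fin n) ℚ) : ℚ :=
  pairQ (topRight g hn (antiDiag n)) (topRight g hn B)

/-! ### The explicit matrices -/

/-- The polynomial `x^n + c₁ x^(n-1) + ⋯ + c_(n-2) x^2 + m c_(n-1) x + m^2 c_n`. -/
def normalForm (n m : ℕ) (c : ℕ → ℤ) : ℤ[X] :=
  X ^ n + ∑ i ∈ Finset.Icc 1 (n - 2), C (c i) * X ^ (n - i)
    + C ((m : ℤ) * c (n - 1)) * X + C ((m : ℤ) ^ 2 * c n)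

/-- The matrix `B_m(c₁, …, c_n)` for `n = 2 g + 1`. With rows and columns numbered from `1`, it is
symmetric, with `m` in position `(1, n - 1)`, ones in the other positions `(i, j)` with
`i + j = n` and `2 ≤ i ≤ j`, `-c_(2k+1)` in position `(g + 1 + k, g + 1 + k)` for `0 ≤ k ≤ g`,
`-c_(2k+2) / 2` in position `(g + 1 + k, g + 2 + k)` for `0 ≤ k < g`, and zeros elsewhere on and
above the diagonal. (The code numbers rows and columns from `0`.) -/
def oddMatrix (g m : ℕ) (c : ℕ → ℤ) : Matrix (Fin (2 * g + 1)) (Fin (2 * g + 1)) ℚ :=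
  Matrix.of fun i j =>
    let a := min i.val j.val
    let b := max i.val j.val
    if a + b + 2 = 2 * g + 1 then (if a = 0 then (m : ℚ) else 1)
    else if a = b ∧ g ≤ a then -(c (2 * (a - g) + 1) : ℚ)
    else if b = a + 1 ∧ g ≤ a then -(c (2 * (a - g) + 2) : ℚ) / 2
    else 0

/-- The matrix `B_m(c₁, …, c_n)` for `n = 2 g + 2`. With rows and columns numbered from `1`, it is
symmetric, with `m` in position `(1, n - 1)`, ones in the other positions `(i, j)` with
`i + j = n` and `2 ≤ i ≤ j`, `c₁ ^ 2 / 4 - c₂` in position `(g + 2, g + 2)`, `-c_(2k+2)` in position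
`(g + 2 + k, g + 2 + k)` for `1 ≤ k ≤ g`, `-c_(2k+1) / 2` in position `(g + 1 + k, g + 2 + k)` for
`0 ≤ k ≤ g`, and zeros elsewhere on and above the diagonal. (The code numbers rows and columns
from `0`.) -/
def evenMatrix (g m : ℕ) (c : ℕ → ℤ) : Matrix (Fin (2 * g + 2)) (Fin (2 * g + 2)) ℚ :=
  Matrix.of fun i j =>
    let a := min i.val j.val
    let b := max i.val j.val
    if a + b + 2 = 2 * g + 2 then (if a = 0 then (m : ℚ) else 1)
    else if a = b ∧ a = g + 1 then (c 1 : ℚ) ^ 2 / 4 - (c 2 : ℚ)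
    else if a = b ∧ g + 1 < a then -(c (2 * (a - g)) : ℚ)
    else if b = a + 1 ∧ g ≤ a then -(c (2 * (a - g) + 1) : ℚ) / 2
    else 0

end SquarefreeDisc

end

/-!
If `f` and its derivative have a common factor of degree `k` modulo `p`, then `k` independent
vectors of the kernel of their Sylvester matrix modulo `p` show that `p ^ k` divides the
discriminant, not only of `f` but of every polynomial congruent to `f`. Weak divisibility by `p ^ 2`
thus leaves `f` modulo `p` a single multiple root, which is rational and exactly double, and forces
`p ≠ 2`. Lifting it to a root `l` of the derivative modulo `p ^ 2`, one reads off from the resultant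
that `p ^ 2` divides the value of `f` at `l`. Chinese remaindering over the primes dividing `m` and
the translation by `l` then give the normal form.

For `B = B_m(c)` the top rows of `A₀ x - B` vanish outside a `g × (g + 1)` block whose kernel is
spanned by `w = (x ^ g, …, x, m)`. Its maximal minors are therefore, up to a common sign, the
entries of `w`. Hence `Q(B) = ± m`, while the bordered determinant `det (A₀ x - B)` is, up to sign,
the value at `w` of the quadratic form of the lower right block, which is the normal form of `f`.
For even `n` this applies after eliminating the pivot `-1` in position `(g + 1, g + 1)`.

Finally, the first row and column of `B` vanish modulo `p` for `p ∣ m`, and so do those of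
`B + p B'`; their common entry vanishes. Hence `p ^ 2` divides the value at `0` of the invariant
polynomial of `B + p B'` and `p` divides the value of its derivative, so `p ^ 2` divides its
discriminant.
-/

noncomputable section

namespace SquarefreeDisc

section KernelVectors

open Matrix

variable {R N : Type*} [CommRing R] [Fintype N] [DecidableEq N]

theorem pow_card_dvd_det {M : Matrix N N R} {a : R} (s : Finset N)
    (h : ∀ j ∈ s, ∀ i, a ∣ M i j) : a ^ s.card ∣ M.det := by
  rw [Matrix.det_apply]
  refine Finset.dvd_sum fun σ _ => (dvd_smul_of_dvd _ ?_)
  calc a ^ s.card = ∏ _j ∈ s, a := (Finset.prod_const a).symm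
    _ ∣ ∏ j ∈ s, M (σ j) j := Finset.prod_dvd_prod_of_dvd _ _ fun j hj => h j hj _
    _ ∣ ∏ j, M (σ j) j := Finset.prod_dvd_prod_of_subset _ _ _ s.subset_univ

theorem sumExtend_inl {K V ι : Type*} [Field K] [AddCommGroup V] [Module K V] {v : ι → V}
    (hv : LinearIndependent K v) (i : ι) : Module.Basis.sumExtend hv (.inl i) = v i := by
  rw [Module.Basis.sumExtend, Module.Basis.reindex_apply, Module.Basis.extend_apply_self]
  rfl

theorem exists_isUnit_col_eq {K ι : Type*} [Field K] {v : ι → N → K}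
    (hv : LinearIndependent K v) :
    ∃ (P : Matrix N N K) (e : ι ↪ N), IsUnit P ∧ ∀ i, P.col (e i) = v i := by
  let b := Module.Basis.sumExtend hv
  let e := b.indexEquiv (Pi.basisFun K N)
  have hcol (i : ι) : b.reindex e (e (.inl i)) = v i := by
    rw [b.reindex_apply, e.symm_apply_apply, sumExtend_inl]
  exact ⟨(Matrix.of (b.reindex e))ᵀ, Function.Embedding.inl.trans e.toEmbedding,
    linearIndependent_cols_iff_isUnit.1 (b.reindex e).linearIndependent, hcol⟩

theorem pow_card_dvd_det_of_linearIndependent {K ι : Type*} [IsDomain R] [Field K] [Fintype ι]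
    {φ : R →+* K} (hφ : Function.Surjective φ) {π : R} (hπ : Prime π)
    (hker : RingHom.ker φ = Ideal.span {π}) {M : Matrix N N R} {v : ι → N → K}
    (hv : LinearIndependent K v) (hM : ∀ i, M.map φ *ᵥ v i = 0) :
    π ^ Fintype.card ι ∣ M.det := by
  have hdvd (a : R) : π ∣ a ↔ φ a = 0 := by
    rw [← RingHom.mem_ker, hker, Ideal.mem_span_singleton]
  obtain ⟨P, e, hP, hPv⟩ := exists_isUnit_col_eq hv
  obtain ⟨P, rfl⟩ : ∃ Q : Matrix N N R, Q.map φ = P :=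
    ⟨P.map (Function.surjInv hφ), Matrix.ext fun i j => Function.surjInv_eq hφ _⟩
  have hdetP : ¬ π ∣ P.det := by
    rw [hdvd, RingHom.map_det]
    exact (isUnit_iff_isUnit_det _).1 hP |>.ne_zero
  have hcols : π ^ (Finset.univ.map e).card ∣ (M * P).det :=
    pow_card_dvd_det _ fun j hj i => by
      obtain ⟨k, -, rfl⟩ := Finset.mem_map.1 hj
      have h := congrFun (hM k) i
      rw [← hPv k] at h
      rwa [hdvd, ← Matrix.map_apply (f := φ), Matrix.map_mul]
  rw [Finset.card_map, Finset.card_univ, det_mul] at hcols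
  exact hπ.pow_dvd_of_dvd_mul_right _ hdetP hcols

end KernelVectors

section Resultant

open Matrix

theorem mul_mem_degreeLT {K : Type*} [Field K] {D e s : K[X]} {m : ℕ} (hD : D ≠ 0)
    (hm : (D * e).natDegree ≤ m) (hs : s ∈ degreeLT K D.natDegree) : e * s ∈ degreeLT K m := by
  rcases eq_or_ne e 0 with rfl | he
  · simp
  rcases eq_or_ne s 0 with rfl | hs0
  · simp
  rw [mem_degreeLT, ← natDegree_lt_iff_degree_lt hs0] at hs
  rw [mem_degreeLT, ← natDegree_lt_iff_degree_lt (mul_ne_zero he hs0), natDegree_mul he hs0]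
  rw [natDegree_mul hD he] at hm
  lia

/-- If `f = D e` and `g = D k`, then the pairs `(s e, - s k)` with `deg s < deg D` satisfy
`f (- s k) + g (s e) = 0`. -/
theorem exists_linearIndependent_sylvester_mulVec_eq_zero {K : Type*} [Field K] {f g D : K[X]}
    {m n : ℕ} (hfm : f.natDegree ≤ m) (hgn : g.natDegree ≤ n) (hf : f ≠ 0) (hDf : D ∣ f)
    (hDg : D ∣ g) :
    ∃ v : Fin D.natDegree → Fin (m + n) → K,
      LinearIndependent K v ∧ ∀ i, sylvester f g m n *ᵥ v i = 0 := by
  obtain ⟨⟨e, rfl⟩, ⟨k, rfl⟩⟩ := hDf, hDg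
  obtain ⟨hD, he⟩ := mul_ne_zero_iff.1 hf
  let L : degreeLT K D.natDegree →ₗ[K] degreeLT K m × degreeLT K n :=
    ((LinearMap.mulLeft K e).restrict fun _ => mul_mem_degreeLT hD hfm).prod
      (-(LinearMap.mulLeft K k).restrict fun _ => mul_mem_degreeLT hD hgn)
  have hL : L.ker = ⊥ := by
    refine LinearMap.ker_eq_bot'.2 fun s hs => Subtype.ext ?_
    have hes : e * s = 0 := congrArg (fun z => (z.1 : K[X])) hs
    exact (mul_eq_zero.1 hes).resolve_left he
  have hsyl (s : degreeLT K D.natDegree) : sylvesterMap (D * e) (D * k) hfm hgn (L s) = 0 := by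
    refine Subtype.ext ?_
    simp only [sylvesterMap_apply_coe, ZeroMemClass.coe_zero]
    change D * e * -(k * s) + D * k * (e * s) = 0
    ring
  let b := ((degreeLT.basis K m).prod (degreeLT.basis K n)).reindex finSumFinEquiv
  refine ⟨fun i => b.equivFun (L (degreeLT.basis K _ i)),
    ((degreeLT.basis K _).linearIndependent.map' L hL).map' _ b.equivFun.ker, fun i => ?_⟩
  rw [← toMatrix_sylvesterMap' _ _ hfm hgn]
  exact (LinearMap.toMatrix_mulVec_repr b _ _ _).trans (by rw [hsyl, map_zero, Finsupp.coe_zero])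

theorem pow_natDegree_dvd_resultant {R K : Type*} [CommRing R] [IsDomain R] [Field K]
    {φ : R →+* K} (hφ : Function.Surjective φ) {π : R} (hπ : Prime π)
    (hker : RingHom.ker φ = Ideal.span {π}) {F G : R[X]} {m n : ℕ} (hFm : F.natDegree ≤ m)
    (hGn : G.natDegree ≤ n) (hF : F.map φ ≠ 0) {D : K[X]} (hDF : D ∣ F.map φ)
    (hDG : D ∣ G.map φ) : π ^ D.natDegree ∣ resultant F G m n := by
  obtain ⟨v, hv, hker_v⟩ := exists_linearIndependent_sylvester_mulVec_eq_zero
    (natDegree_map_le.trans hFm) (natDegree_map_le.trans hGn) hF hDF hDG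
  rw [sylvester_map_map] at hker_v
  have h := pow_card_dvd_det_of_linearIndependent hφ hπ hker hv hker_v
  rwa [Fintype.card_fin] at h

end Resultant

section DoubleRoots

theorem resultant_X_sub_C_mul_right {R : Type*} [CommRing R] {f k : R[X]} {m d : ℕ} (a : R)
    (hf : f.natDegree ≤ m) (hk : k.natDegree ≤ d) :
    resultant f ((X - C a) * k) m (1 + d) = (-1) ^ m * f.eval a * resultant f k m d := by
  nontriviality R
  obtain ⟨t, rfl⟩ := Nat.exists_eq_add_of_le hk
  have hmul := resultant_mul_right f (X - C a) k m hf
  have hdeg : ((X - C a) * k).natDegree ≤ 1 + k.natDegree :=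
    natDegree_mul_le.trans_eq (by rw [natDegree_X_sub_C])
  rw [natDegree_X_sub_C, resultant_X_sub_C_right _ _ _ hf] at hmul
  rw [← add_assoc, resultant_add_right_deg _ _ _ _ _ hdeg, hmul,
    resultant_add_right_deg _ _ _ _ _ le_rfl]
  ring

theorem discr_eq_zero_of_isRoot {R : Type*} [CommRing R] {F : R[X]} {l : R} (hF : F.Monic)
    (hn : 2 ≤ F.natDegree) (h0 : F.IsRoot l) (h1 : (derivative F).eval l ^ 2 = 0) :
    F.discr = 0 := by
  nontriviality R
  obtain ⟨k, rfl⟩ := dvd_iff_isRoot.2 h0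
  have hk : k.Monic := (monic_X_sub_C l).of_mul_monic_left hF
  have hdeg : ((X - C l) * k).natDegree = 1 + k.natDegree := by
    rw [(monic_X_sub_C l).natDegree_mul hk, natDegree_X_sub_C]
  have hder : derivative ((X - C l) * k) = (X - C l) * derivative k + k * 1 := by
    rw [derivative_mul, derivative_X_sub_C]
    ring
  have hkl : (derivative ((X - C l) * k)).eval l = k.eval l := by
    simp [hder]
  have hder_deg : (derivative ((X - C l) * k)).natDegree ≤ k.natDegree :=
    (natDegree_derivative_le _).trans_eq (by rw [hdeg, Nat.add_sub_cancel_left])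
  have hres : resultant k (derivative ((X - C l) * k)) k.natDegree k.natDegree =
      (-1) ^ k.natDegree * k.eval l *
        resultant k (derivative k) k.natDegree (k.natDegree - 1) := by
    rw [hder, resultant_add_mul_right _ _ _ _ _ (by simp) le_rfl,
      ← resultant_X_sub_C_mul_right l le_rfl (natDegree_derivative_le k)]
    congr 1
    lia
  have hzero := resultant_mul_left (X - C l) k (derivative ((X - C l) * k)) k.natDegree hder_deg
  rw [natDegree_X_sub_C, resultant_X_sub_C_left _ _ _ hder_deg, hres, hkl] at hzero
  have hdiscr := resultant_deriv (natDegree_pos_iff_degree_pos.1 (two_pos.trans_le hn))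
  rw [hF.leadingCoeff, hdeg, Nat.add_sub_cancel_left, hzero] at hdiscr
  rw [hkl] at h1
  rw [mul_one] at hdiscr
  refine (isUnit_one.neg.pow _).mul_right_eq_zero.1 (hdiscr.symm.trans ?_)
  linear_combination ((-1) ^ k.natDegree * resultant k (derivative k) k.natDegree _) * h1

theorem discr_map {R S : Type*} [CommRing R] [CommRing S] (φ : R →+* S) {F : R[X]} (hF : F.Monic)
    (hn : 0 < F.natDegree) : (F.map φ).discr = φ F.discr := by
  nontriviality S
  have hdeg := hF.natDegree_map φ
  have hR := congrArg φ (resultant_deriv (natDegree_pos_iff_degree_pos.1 hn))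
  have hS := resultant_deriv (natDegree_pos_iff_degree_pos.1 (hdeg ▸ hn))
  rw [(hF.map φ).leadingCoeff, hdeg, derivative_map, resultant_map_map, hR, hF.leadingCoeff] at hS
  simp only [map_mul, map_pow, map_neg, map_one] at hS
  exact ((isUnit_one.neg.pow _).mul_left_cancel (by simpa only [mul_one] using hS)).symm

theorem sq_dvd_discr {R : Type*} [CommRing R] {F : R[X]} {q l : R} (hF : F.Monic)
    (hn : 2 ≤ F.natDegree) (h0 : q ^ 2 ∣ F.eval l) (h1 : q ∣ (derivative F).eval l) :
    q ^ 2 ∣ F.discr := by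
  let φ := Ideal.Quotient.mk (Ideal.span {q ^ 2})
  have hφ (a : R) : φ a = 0 ↔ q ^ 2 ∣ a := by
    rw [Ideal.Quotient.eq_zero_iff_mem, Ideal.mem_span_singleton]
  rcases subsingleton_or_nontrivial (R ⧸ Ideal.span {q ^ 2}) with hS | hS
  · exact (hφ _).1 (Subsingleton.elim _ _)
  rw [← hφ, ← discr_map φ hF (two_pos.trans_le hn)]
  refine discr_eq_zero_of_isRoot (l := φ l) (hF.map φ) (hn.trans_eq (hF.natDegree_map φ).symm) ?_ ?_
  · rw [IsRoot, eval_map_apply, (hφ _).2 h0]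
  · rw [derivative_map, eval_map_apply, ← map_pow, hφ]
    exact pow_dvd_pow_of_dvd h1 2

theorem sub_eval_eq_X_sub_C_mul {R : Type*} [CommRing R] (g : R[X]) (l : R) :
    g - C (g.eval l) = (X - C l) * (g /ₘ (X - C l)) := by
  rw [X_sub_C_mul_divByMonic_eq_sub_modByMonic, modByMonic_X_sub_C_eq_C_eval]

theorem dvd_eval_mul_resultant {R : Type*} [CommRing R] {f g : R[X]} {a l : R} {m d : ℕ}
    (hf : f.natDegree ≤ m) (hg : g.natDegree ≤ 1 + d) (hl : a ∣ g.eval l)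
    (h : a ∣ resultant f g m (1 + d)) :
    a ∣ f.eval l * resultant f (g /ₘ (X - C l)) m d := by
  nontriviality R
  let φ := Ideal.Quotient.mk (Ideal.span {a})
  have hφ (b : R) : φ b = 0 ↔ a ∣ b := by
    rw [Ideal.Quotient.eq_zero_iff_mem, Ideal.mem_span_singleton]
  have hk : (g /ₘ (X - C l)).natDegree ≤ d := by
    rw [natDegree_divByMonic _ (monic_X_sub_C l), natDegree_X_sub_C]
    lia
  have hmap : g.map φ = ((X - C l) * (g /ₘ (X - C l))).map φ := by
    rw [← sub_eval_eq_X_sub_C_mul, Polynomial.map_sub, map_C, (hφ _).2 hl, C_0, sub_zero]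
  have hres : φ (resultant f ((X - C l) * (g /ₘ (X - C l))) m (1 + d)) = 0 := by
    rw [← resultant_map_map, ← hmap, resultant_map_map, (hφ _).2 h]
  rw [hφ, resultant_X_sub_C_mul_right l hf hk, mul_assoc] at hres
  exact (isUnit_one.neg.pow m).dvd_mul_left.1 hres

end DoubleRoots

section WeakDivisibility

theorem exists_isRoot_of_not_isCoprime {K : Type*} [Field K] {f g : K[X]} (hf : f ≠ 0)
    (hfg : ¬ IsCoprime f g) (H : ∀ D, D ∣ f → D ∣ g → D.natDegree ≤ 1) :
    ∃ r, f.IsRoot r ∧ g.IsRoot r := by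
  obtain ⟨D, hD, hDf, hDg⟩ : ∃ D, Irreducible D ∧ D ∣ f ∧ D ∣ g := by
    contrapose! hfg
    exact isCoprime_of_irreducible_dvd (fun h => hf h.1) hfg
  obtain ⟨r, hr⟩ := exists_root_of_degree_eq_one <|
    (degree_eq_iff_natDegree_eq_of_pos one_pos).2 ((H D hDf hDg).antisymm hD.natDegree_pos)
  exact ⟨r, hr.dvd hDf, hr.dvd hDg⟩

theorem isCoprime_of_derivative_eq_X_sub_C_mul {K : Type*} [Field K] {f k : K[X]} {r : K}
    (hf : f ≠ 0) (hr : f.IsRoot r) (hk : derivative f = (X - C r) * k)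
    (H : ∀ D, D ∣ f → D ∣ derivative f → D.natDegree ≤ 1) : IsCoprime f k := by
  refine isCoprime_of_irreducible_dvd (fun h => hf h.1) fun D hD hDf hDk => ?_
  by_cases hrD : X - C r ∣ D
  · have hr' : (derivative f).IsRoot r := dvd_iff_isRoot.1 (hk ▸ dvd_mul_right _ _)
    have hsq : (X - C r) ^ 2 ∣ f :=
      (le_rootMultiplicity_iff hf).1 ((one_lt_rootMultiplicity_iff_isRoot hf).2 ⟨hr, hr'⟩)
    have hdeg := H _ hsq (by rw [hk, sq]; exact mul_dvd_mul_left _ (hrD.trans hDk))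
    rw [natDegree_pow, natDegree_X_sub_C] at hdeg
    lia
  · have hcop : IsCoprime (X - C r) D := (irreducible_X_sub_C r).coprime_iff_not_dvd.2 hrD
    have hdeg := H _ (hcop.mul_dvd (dvd_iff_isRoot.2 hr) hDf) (hk ▸ mul_dvd_mul_left _ hDk)
    rw [natDegree_mul (X_sub_C_ne_zero r) hD.ne_zero, natDegree_X_sub_C] at hdeg
    have := hD.natDegree_pos
    lia

theorem dvd_resultant_iff_not_isCoprime {p : ℕ} [Fact p.Prime] {f g : ℤ[X]} {d : ℕ} (hf : f.Monic)
    (hg : g.natDegree ≤ d) :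
    (p : ℤ) ∣ resultant f g f.natDegree d ↔
      ¬ IsCoprime (f.map (Int.castRingHom (ZMod p))) (g.map (Int.castRingHom (ZMod p))) := by
  have hfp := hf.map (Int.castRingHom (ZMod p))
  have hgd : (g.map (Int.castRingHom (ZMod p))).natDegree ≤ d := natDegree_map_le.trans hg
  obtain ⟨t, rfl⟩ := Nat.exists_eq_add_of_le hgd
  rw [← ZMod.intCast_zmod_eq_zero_iff_dvd, ← eq_intCast (Int.castRingHom (ZMod p)),
    ← resultant_map_map, ← hf.natDegree_map (Int.castRingHom (ZMod p)),
    resultant_add_right_deg _ _ _ _ _ le_rfl, coeff_natDegree, hfp.leadingCoeff, one_pow, one_mul,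
    ← isUnit_resultant_iff_isCoprime hfp, isUnit_iff_ne_zero, not_not]

theorem exists_sq_dvd_eval {R : Type*} [CommRing R] {g : R[X]} {q t : R} (h : q ∣ g.eval t)
    (h' : IsCoprime q ((derivative g).eval t)) : ∃ l, q ^ 2 ∣ g.eval l ∧ q ∣ l - t := by
  obtain ⟨⟨a, ha⟩, ⟨u, v, huv⟩⟩ := h, h'
  obtain ⟨k, hk⟩ := binomExpansion g t (q * (-a * v))
  refine ⟨t + q * (-a * v), ⟨a * u + k * (a * v) ^ 2, ?_⟩, -a * v, by ring⟩
  rw [hk, ha]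
  linear_combination (-q * a) * huv

theorem sq_dvd_discr_iff {p : ℕ} (hp : p.Prime) {F : ℤ[X]} (hF : 0 < F.natDegree)
    (hlc : ¬ (p : ℤ) ∣ F.leadingCoeff) :
    (p : ℤ) ^ 2 ∣ F.discr ↔
      (p : ℤ) ^ 2 ∣ resultant F (derivative F) F.natDegree (F.natDegree - 1) := by
  have hcop : IsCoprime ((p : ℤ) ^ 2) F.leadingCoeff :=
    ((Nat.prime_iff_prime_int.1 hp).irreducible.coprime_iff_not_dvd.2 hlc).pow_left
  rw [resultant_deriv (natDegree_pos_iff_degree_pos.1 hF), mul_assoc,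
    (isUnit_one.neg.pow _).dvd_mul_left]
  exact ⟨fun h => h.mul_left _, hcop.dvd_of_dvd_mul_left⟩

theorem natDegree_le_one_of_dvd_of_dvd_derivative {p : ℕ} [hp : Fact p.Prime] {F : ℤ[X]}
    (hF : 0 < F.natDegree) (hlc : ¬ (p : ℤ) ∣ F.leadingCoeff) (hdisc : ¬ (p : ℤ) ^ 2 ∣ F.discr)
    {D : (ZMod p)[X]} (hDF : D ∣ F.map (Int.castRingHom (ZMod p)))
    (hDF' : D ∣ derivative (F.map (Int.castRingHom (ZMod p)))) : D.natDegree ≤ 1 := by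
  by_contra! hD
  have hF0 : F.map (Int.castRingHom (ZMod p)) ≠ 0 := fun h => hlc <| by
    rw [← ZMod.intCast_zmod_eq_zero_iff_dvd, leadingCoeff, ← eq_intCast (Int.castRingHom (ZMod p)),
      ← coeff_map, h, coeff_zero]
  rw [sq_dvd_discr_iff hp.out hF hlc] at hdisc
  rw [derivative_map] at hDF'
  refine hdisc ((pow_dvd_pow _ hD).trans ?_)
  exact pow_natDegree_dvd_resultant (ZMod.ringHom_surjective (Int.castRingHom (ZMod p)))
    (Nat.prime_iff_prime_int.1 hp.out) (ZMod.ker_intCastRingHom p) le_rfl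
    (natDegree_derivative_le F) hF0 hDF hDF'

theorem WeaklyDvdDisc.natDegree_le_one {p : ℕ} [hp : Fact p.Prime] {f : ℤ[X]} (hf : f.Monic)
    (hn : 0 < f.natDegree) (hw : WeaklyDvdDisc p f) {D : (ZMod p)[X]}
    (hDf : D ∣ f.map (Int.castRingHom (ZMod p)))
    (hDf' : D ∣ derivative (f.map (Int.castRingHom (ZMod p)))) : D.natDegree ≤ 1 := by
  obtain ⟨h, hh, hdisc⟩ : ∃ h : ℤ[X], h.natDegree = f.natDegree ∧
      ¬ (p : ℤ) ^ 2 ∣ (f + C (p : ℤ) * h).discr := by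
    by_contra! hall
    exact hw.2 ⟨hw.1, hall⟩
  have hcoeff : (f + C (p : ℤ) * h).coeff f.natDegree = 1 + p * h.coeff f.natDegree := by
    rw [coeff_add, coeff_C_mul, hf.coeff_natDegree]
  have hlc : ¬ (p : ℤ) ∣ (f + C (p : ℤ) * h).coeff f.natDegree := fun hdvd =>
    (Nat.prime_iff_prime_int.1 hp.out).not_dvd_one
      ((dvd_add_left (dvd_mul_right _ _)).1 (hcoeff ▸ hdvd))
  have hdeg : (f + C (p : ℤ) * h).natDegree = f.natDegree :=
    natDegree_eq_of_le_of_coeff_ne_zero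
      (natDegree_add_le_of_degree_le le_rfl ((natDegree_C_mul_le _ _).trans hh.le))
      fun h0 => hlc (h0 ▸ dvd_zero _)
  have hmap : (f + C (p : ℤ) * h).map (Int.castRingHom (ZMod p)) =
      f.map (Int.castRingHom (ZMod p)) := by
    simp
  rw [← hmap] at hDf hDf'
  exact natDegree_le_one_of_dvd_of_dvd_derivative (hdeg ▸ hn) (by rwa [leadingCoeff, hdeg])
    hdisc hDf hDf'

theorem eval_derivative_derivative_ne_zero {K : Type*} [Field K] {f : K[X]} {r : K} (hf : f ≠ 0)
    (hr : f.IsRoot r) (hr' : (derivative f).IsRoot r)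
    (H : ∀ D, D ∣ f → D ∣ derivative f → D.natDegree ≤ 1) :
    (derivative (derivative f)).eval r ≠ 0 := by
  obtain ⟨k, hk⟩ := dvd_iff_isRoot.2 hr'
  obtain ⟨u, v, huv⟩ := isCoprime_of_derivative_eq_X_sub_C_mul hf hr hk H
  intro h0
  have hkr : k.eval r = 0 := by simpa [hk] using h0
  simpa [hr.eq_zero, hkr] using congrArg (eval r) huv

theorem derivative_derivative {R : Type*} [CommRing R] (f : R[X]) :
    derivative (derivative f) = 2 • hasseDeriv 2 f :=
  (congrFun (factorial_smul_hasseDeriv (R := R) 2) f).symm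

theorem isRoot_map_intCastRingHom_iff {p : ℕ} {f : ℤ[X]} {t : ℤ} :
    (f.map (Int.castRingHom (ZMod p))).IsRoot (t : ZMod p) ↔ (p : ℤ) ∣ f.eval t := by
  rw [IsRoot, eval_intCast_map, Int.cast_id, eq_intCast, ZMod.intCast_zmod_eq_zero_iff_dvd]

section WeaklyDvd

variable {p : ℕ} [hp : Fact p.Prime] {f : ℤ[X]}

theorem WeaklyDvdDisc.exists_dvd_eval (hf : f.Monic) (hn : 0 < f.natDegree)
    (hw : WeaklyDvdDisc p f) :
    ∃ t : ℤ, (p : ℤ) ∣ f.eval t ∧ (p : ℤ) ∣ (derivative f).eval t ∧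
      ¬ (p : ℤ) ∣ (derivative (derivative f)).eval t := by
  have H := fun D => hw.natDegree_le_one hf hn (D := D)
  have hfp := (hf.map (Int.castRingHom (ZMod p))).ne_zero
  have hres : (p : ℤ) ∣ resultant f (derivative f) f.natDegree (f.natDegree - 1) := by
    rw [resultant_deriv (natDegree_pos_iff_degree_pos.1 hn)]
    exact ((dvd_pow_self _ two_ne_zero).trans hw.1).mul_left _
  have hcop := (dvd_resultant_iff_not_isCoprime hf (natDegree_derivative_le f)).1 hres
  rw [← derivative_map] at hcop
  obtain ⟨r, hr, hr'⟩ := exists_isRoot_of_not_isCoprime hfp hcop H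
  obtain ⟨t, rfl⟩ := ZMod.intCast_surjective r
  have hr'' := eval_derivative_derivative_ne_zero hfp hr hr' H
  rw [derivative_map] at hr'
  rw [derivative_map, derivative_map] at hr''
  exact ⟨t, isRoot_map_intCastRingHom_iff.1 hr, isRoot_map_intCastRingHom_iff.1 hr',
    fun h => hr'' (isRoot_map_intCastRingHom_iff.2 h)⟩

theorem WeaklyDvdDisc.ne_two (hf : f.Monic) (hn : 0 < f.natDegree) (hw : WeaklyDvdDisc p f) :
    p ≠ 2 := by
  rintro rfl
  obtain ⟨t, -, -, ht⟩ := hw.exists_dvd_eval hf hn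
  refine ht ?_
  rw [derivative_derivative, eval_smul, nsmul_eq_mul]
  exact dvd_mul_right _ _

theorem WeaklyDvdDisc.not_dvd_resultant_divByMonic (hf : f.Monic) (hn : 2 ≤ f.natDegree)
    (hw : WeaklyDvdDisc p f) {l : ℤ} (hl : (p : ℤ) ∣ f.eval l)
    (hl' : (p : ℤ) ∣ (derivative f).eval l) :
    ¬ (p : ℤ) ∣ resultant f (derivative f /ₘ (X - C l)) f.natDegree (f.natDegree - 2) := by
  have hdeg : (derivative f /ₘ (X - C l)).natDegree ≤ f.natDegree - 2 := by
    rw [natDegree_divByMonic _ (monic_X_sub_C l), natDegree_X_sub_C]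
    exact Nat.sub_le_sub_right (natDegree_derivative_le f) 1
  rw [dvd_resultant_iff_not_isCoprime hf hdeg, not_not,
    map_divByMonic _ (monic_X_sub_C l), Polynomial.map_sub, map_X, map_C, eq_intCast]
  refine isCoprime_of_derivative_eq_X_sub_C_mul (hf.map _).ne_zero
    (isRoot_map_intCastRingHom_iff.2 hl) ?_ fun _ => hw.natDegree_le_one hf (two_pos.trans_le hn)
  rw [derivative_map]
  exact (mul_divByMonic_eq_iff_isRoot.2 (isRoot_map_intCastRingHom_iff.2 hl')).symm

theorem WeaklyDvdDisc.exists_sq_dvd_eval (hf : f.Monic) (hn : 2 ≤ f.natDegree)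
    (hw : WeaklyDvdDisc p f) :
    ∃ l : ℤ, (p : ℤ) ^ 2 ∣ f.eval l ∧ (p : ℤ) ∣ (derivative f).eval l := by
  have hpp := Nat.prime_iff_prime_int.1 hp.out
  obtain ⟨t, ht, ht', ht''⟩ := hw.exists_dvd_eval hf (two_pos.trans_le hn)
  obtain ⟨l, hl', hlt⟩ :=
    SquarefreeDisc.exists_sq_dvd_eval ht' (hpp.irreducible.coprime_iff_not_dvd.2 ht'')
  have hl'_dvd := (dvd_pow_self _ two_ne_zero).trans hl'
  have hl : (p : ℤ) ∣ f.eval l :=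
    (dvd_sub_left ht).1 (hlt.trans (sub_dvd_eval_sub l t f))
  have hres : (p : ℤ) ^ 2 ∣ resultant f (derivative f) f.natDegree (1 + (f.natDegree - 2)) := by
    rw [show 1 + (f.natDegree - 2) = f.natDegree - 1 by lia,
      resultant_deriv (natDegree_pos_iff_degree_pos.1 (two_pos.trans_le hn))]
    exact hw.1.mul_left _
  have hcop := hpp.irreducible.coprime_iff_not_dvd.2
    (hw.not_dvd_resultant_divByMonic hf hn hl hl'_dvd)
  refine ⟨l, hcop.pow_left.dvd_of_dvd_mul_right ?_, hl'_dvd⟩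
  exact dvd_eval_mul_resultant le_rfl ((natDegree_derivative_le f).trans (by lia)) hl' hres

end WeaklyDvd

end WeakDivisibility

section NormalForm

theorem isCoprime_pow_of_mem_primeFactors {m p q : ℕ} (k : ℕ) (hp : p ∈ m.primeFactors)
    (hq : q ∈ m.primeFactors) (hpq : p ≠ q) : IsCoprime ((p : ℤ) ^ k) ((q : ℤ) ^ k) :=
  (Nat.isCoprime_iff_coprime.2 ((Nat.coprime_primes (Nat.prime_of_mem_primeFactors hp)
    (Nat.prime_of_mem_primeFactors hq)).2 hpq)).pow

theorem exists_forall_prime_pow_dvd_sub (m k : ℕ) (l : ℕ → ℤ) :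
    ∃ x, ∀ p ∈ m.primeFactors, (p : ℤ) ^ k ∣ x - l p := by
  have hcop : Pairwise (Function.onFun IsCoprime fun p : m.primeFactors =>
      Ideal.span {(p : ℤ) ^ k}) := fun p q hpq =>
    (Ideal.isCoprime_span_singleton_iff _ _).2
      (isCoprime_pow_of_mem_primeFactors k p.2 q.2 (Subtype.coe_ne_coe.2 hpq))
  obtain ⟨x, hx⟩ := Ideal.exists_forall_sub_mem_ideal hcop fun p => l p
  exact ⟨x, fun p hp => Ideal.mem_span_singleton.1 (hx ⟨p, hp⟩)⟩

theorem pow_dvd_of_forall_prime_pow_dvd {m k : ℕ} (hm : Squarefree m) {z : ℤ}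
    (h : ∀ p ∈ m.primeFactors, (p : ℤ) ^ k ∣ z) : (m : ℤ) ^ k ∣ z := by
  rw [← Nat.prod_primeFactors_of_squarefree hm, Nat.cast_prod, ← Finset.prod_pow]
  exact Finset.prod_dvd_of_coprime
    (fun p hp q hq hpq => isCoprime_pow_of_mem_primeFactors k hp hq hpq) h

theorem exists_sq_dvd_eval_of_mem_weakSet {n m : ℕ} (hm : Squarefree m) (hn : 2 ≤ n) {f : ℤ[X]}
    (hf : f ∈ weakSet n m) :
    ∃ l : ℤ, (m : ℤ) ^ 2 ∣ f.eval l ∧ (m : ℤ) ∣ (derivative f).eval l := by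
  obtain ⟨hmon, rfl, hw⟩ := hf
  have hlocal (p : ℕ) (hp : p ∈ m.primeFactors) :
      ∃ l : ℤ, (p : ℤ) ^ 2 ∣ f.eval l ∧ (p : ℤ) ∣ (derivative f).eval l :=
    have := Fact.mk (Nat.prime_of_mem_primeFactors hp)
    (hw p this.out (Nat.dvd_of_mem_primeFactors hp)).exists_sq_dvd_eval hmon hn
  choose! l hl hl' using hlocal
  obtain ⟨x, hx⟩ := exists_forall_prime_pow_dvd_sub m 2 l
  refine ⟨x, pow_dvd_of_forall_prime_pow_dvd hm fun p hp => ?_, ?_⟩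
  · exact (dvd_iff_dvd_of_dvd_sub ((hx p hp).trans (sub_dvd_eval_sub x _ f))).2 (hl p hp)
  · rw [← pow_one (m : ℤ)]
    refine pow_dvd_of_forall_prime_pow_dvd hm fun p hp => ?_
    have hpx := ((dvd_pow_self _ two_ne_zero).trans (hx p hp)).trans
      (sub_dvd_eval_sub x (l p) (derivative f))
    rw [pow_one]
    exact (dvd_iff_dvd_of_dvd_sub hpx).2 (hl' p hp)

theorem normalForm_add_two (k m : ℕ) (c : ℕ → ℤ) :
    normalForm (k + 2) m c = X ^ (k + 2) + ∑ i ∈ Finset.range k, C (c (i + 1)) * X ^ (k + 1 - i) +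
      C ((m : ℤ) * c (k + 1)) * X + C ((m : ℤ) ^ 2 * c (k + 2)) := by
  rw [normalForm, Nat.add_sub_cancel, ← Finset.Ico_add_one_right_eq_Icc, Finset.range_eq_Ico,
    ← Finset.sum_Ico_add' (fun i => C (c i) * X ^ (k + 2 - i)) 0 k 1]
  simp only [Nat.reduceSubDiff]

theorem map_normalForm_add_two (k m : ℕ) (c : ℕ → ℤ) :
    (normalForm (k + 2) m c).map (Int.castRingHom ℚ) =
      X ^ (k + 2) + ∑ i ∈ Finset.range k, C (c (i + 1) : ℚ) * X ^ (k + 1 - i) +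
        C (m : ℚ) * C (c (k + 1) : ℚ) * X + C (m : ℚ) ^ 2 * C (c (k + 2) : ℚ) := by
  simp [normalForm_add_two, Polynomial.map_sum]

theorem exists_eq_normalForm {m n : ℕ} (hn : 2 ≤ n) {F : ℤ[X]} (hF : F.Monic)
    (hFn : F.natDegree = n) (h0 : (m : ℤ) ^ 2 ∣ F.coeff 0) (h1 : (m : ℤ) ∣ F.coeff 1) :
    ∃ c : ℕ → ℤ, F = normalForm n m c := by
  obtain ⟨⟨u, hu⟩, ⟨v, hv⟩⟩ := h0, h1
  obtain ⟨k, rfl⟩ := Nat.exists_eq_add_of_le' hn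
  refine ⟨fun i => if i = k + 2 then u else if i = k + 1 then v else F.coeff (k + 2 - i), ?_⟩
  rw [normalForm_add_two]
  conv_lhs => rw [hF.as_sum, hFn, Finset.sum_range_succ', Finset.sum_range_succ', hu, hv,
    ← Finset.sum_range_reflect]
  have hsum : ∀ i ∈ Finset.range k, C (F.coeff (k - 1 - i + 1 + 1)) * X ^ (k - 1 - i + 1 + 1) =
      C (if i + 1 = k + 2 then u else if i + 1 = k + 1 then v else F.coeff (k + 2 - (i + 1))) *
        X ^ (k + 1 - i) := fun i hi => by
    have := Finset.mem_range.1 hi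
    rw [if_neg (by lia), if_neg (by lia), show k - 1 - i + 1 + 1 = k + 1 - i by lia,
      show k + 2 - (i + 1) = k + 1 - i by lia]
  rw [Finset.sum_congr rfl hsum]
  simp [add_assoc]

theorem exists_comp_eq_normalForm {m n : ℕ} (hm : Squarefree m) (hn : 2 ≤ n) {f : ℤ[X]}
    (hf : f ∈ weakSet n m) :
    ∃ (l : ℤ) (c : ℕ → ℤ), f.comp (X + C l) = normalForm n m c := by
  obtain ⟨l, hl, hl'⟩ := exists_sq_dvd_eval_of_mem_weakSet hm hn hf
  obtain ⟨c, hc⟩ := exists_eq_normalForm hn (hf.1.comp_X_add_C l)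
    ((natDegree_taylor f l).trans hf.2.1) ((taylor_coeff_zero l f).symm ▸ hl)
    ((taylor_coeff_one l f).symm ▸ hl')
  exact ⟨l, c, hc⟩

end NormalForm

section AntiDiagonal

theorem antiDiag_apply (n : ℕ) (i j : Fin n) :
    antiDiag n i j = if i.rev = j then 1 else 0 := by
  rw [antiDiag, Matrix.of_apply]
  congr 1
  rw [Fin.ext_iff, Fin.val_rev, eq_iff_iff]
  lia

theorem antiDiag_mul {n : ℕ} (B : Matrix (Fin n) (Fin n) ℚ) :
    antiDiag n * B = B.submatrix Fin.rev id := by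
  ext i j
  simp [Matrix.mul_apply, antiDiag_apply]

theorem antiDiag_mul_self (n : ℕ) : antiDiag n * antiDiag n = 1 := by
  ext i j
  rw [antiDiag_mul, Matrix.submatrix_apply, id, antiDiag_apply, Fin.rev_rev, Matrix.one_apply]

theorem isSymm_antiDiag (n : ℕ) : (antiDiag n).IsSymm := by
  ext i j
  simp only [antiDiag, Matrix.transpose_apply, Matrix.of_apply, add_comm i.val]

theorem det_of_antitriangular {R : Type*} [CommRing R] {n : ℕ} (M : Matrix (Fin n) (Fin n) R)
    (h : ∀ i j : Fin n, n ≤ i.val + j.val → M i j = 0) :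
    M.det = (-1) ^ (n * (n - 1) / 2) * ∏ i, M i i.rev := by
  induction n with
  | zero => simp
  | succ n ih =>
    have hminor := ih (M.submatrix Fin.castSucc Fin.succ) fun i j hij => h _ _ (by
      rw [Fin.val_castSucc, Fin.val_succ]
      lia)
    rw [Matrix.det_succ_row M (Fin.last n), Finset.sum_eq_single 0]
    · rw [Fin.succAbove_last, Fin.succAbove_zero, hminor, Nat.triangle_succ, pow_add,
        Fin.prod_univ_castSucc, Fin.rev_last]
      simp only [Matrix.submatrix_apply, Fin.rev_castSucc, Fin.val_last, Fin.val_zero]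
      ring
    · intro j _ hj
      rw [h _ j (by
        have := Fin.pos_iff_ne_zero.2 hj
        rw [Fin.lt_def, Fin.val_zero] at this
        rw [Fin.val_last]
        lia), mul_zero, zero_mul]
    · simp

theorem det_antiDiag (n : ℕ) : (antiDiag n).det = (-1) ^ (n * (n - 1) / 2) := by
  rw [det_of_antitriangular _ fun i j hij => by rw [antiDiag, Matrix.of_apply, if_neg (by lia)]]
  simp [antiDiag_apply]

theorem invPoly_eq_charpoly {n : ℕ} (B : Matrix (Fin n) (Fin n) ℚ) :
    invPoly B = (antiDiag n * B).charpoly := by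
  have hself : (antiDiag n).map (C : ℚ →+* ℚ[X]) * (antiDiag n).map C = 1 := by
    rw [← Matrix.map_mul, antiDiag_mul_self, Matrix.map_one _ C_0 C_1]
  have hcharmatrix : (antiDiag n * B).charmatrix =
      (antiDiag n).map C * ((X : ℚ[X]) • (antiDiag n).map C - B.map C) := by
    rw [Matrix.charmatrix, RingHom.mapMatrix_apply, Matrix.map_mul, Matrix.mul_sub,
      Matrix.mul_smul, hself, Matrix.smul_one_eq_diagonal, Matrix.scalar_apply]
  rw [Matrix.charpoly, hcharmatrix, Matrix.det_mul, invPoly, ← RingHom.mapMatrix_apply,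
    ← RingHom.map_det, det_antiDiag, map_pow, map_neg, map_one]

theorem antiDiag_mul_add_smul {n : ℕ} (B : Matrix (Fin n) (Fin n) ℚ) (l : ℚ) :
    antiDiag n * (B + l • antiDiag n) = B.submatrix Fin.rev id + Matrix.scalar (Fin n) l := by
  rw [Matrix.mul_add, Matrix.mul_smul, antiDiag_mul_self, antiDiag_mul,
    Matrix.smul_one_eq_diagonal, Matrix.scalar_apply]

theorem invPoly_add_smul_antiDiag {n : ℕ} (B : Matrix (Fin n) (Fin n) ℚ) (l : ℚ) :
    invPoly (B + l • antiDiag n) = (invPoly B).comp (X - C l) := by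
  rw [invPoly_eq_charpoly, invPoly_eq_charpoly, antiDiag_mul_add_smul, antiDiag_mul,
    ← sub_neg_eq_add, ← map_neg, Matrix.charpoly_sub_scalar, C_neg, ← sub_eq_add_neg]

theorem add_mem_W0Lattice {g n d : ℕ} {A B : Matrix (Fin n) (Fin n) ℚ}
    (hA : A ∈ W0Lattice g n d) (hB : B ∈ W0Lattice g n d) : A + B ∈ W0Lattice g n d := by
  refine ⟨⟨hA.1.1.add hB.1.1, fun i j hi hj => ?_⟩, fun i j => ?_⟩
  · rw [Matrix.add_apply, hA.1.2 i j hi hj, hB.1.2 i j hi hj, add_zero]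
  · obtain ⟨a, ha⟩ := hA.2 i j
    obtain ⟨b, hb⟩ := hB.2 i j
    exact ⟨a + b, by rw [Matrix.add_apply, mul_add, ha, hb, Int.cast_add]⟩

theorem smul_antiDiag_mem_W0Lattice (g n d : ℕ) (l : ℤ) :
    (l : ℚ) • antiDiag n ∈ W0Lattice g n d := by
  refine ⟨⟨(isSymm_antiDiag n).smul _, fun i j hi hj => ?_⟩, fun i j => ?_⟩
  · rw [Matrix.smul_apply, antiDiag, Matrix.of_apply, if_neg (by lia), smul_zero]
  · refine ⟨if i.rev = j then d * l else 0, ?_⟩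
    rw [Matrix.smul_apply, antiDiag_apply]
    split_ifs <;> simp

end AntiDiagonal

section StrongDivisibility

theorem det_mem_sq {R ι : Type*} [CommRing R] [Fintype ι] [DecidableEq ι] (I : Ideal R)
    (M : Matrix ι ι R) {r c : ι} (h0 : M r c = 0) (hr : ∀ j, M r j ∈ I) (hc : ∀ i, M i c ∈ I) :
    M.det ∈ I ^ 2 := by
  rw [Matrix.det_apply]
  refine Ideal.sum_mem _ fun s _ => Submodule.smul_of_tower_mem _ _ ?_
  by_cases hs : s c = r
  · rw [Finset.prod_eq_zero (Finset.mem_univ c) (by rw [hs, h0])]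
    exact Ideal.zero_mem _
  · have hne : s⁻¹ r ≠ c := fun h => hs (Equiv.Perm.inv_eq_iff_eq.1 h).symm
    rw [← Finset.mul_prod_erase _ _ (Finset.mem_univ c),
      ← Finset.mul_prod_erase _ _ (Finset.mem_erase.2 ⟨hne, Finset.mem_univ _⟩), ← mul_assoc,
      pow_two, show s (s⁻¹ r) = r from s.apply_symm_apply r]
    exact Ideal.mul_mem_right _ _ (Ideal.mul_mem_mul (hc _) (hr _))

theorem sq_dvd_eval_and_dvd_eval_derivative {R : Type*} [CommRing R] {q l : R} {F : R[X]}
    (hF : F ∈ (Ideal.span {q}).comap (evalRingHom l) ^ 2) :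
    q ^ 2 ∣ F.eval l ∧ q ∣ (derivative F).eval l := by
  rw [pow_two] at hF
  induction hF using Submodule.mul_induction_on' with
  | mem_mul_mem a ha b hb =>
    rw [Ideal.mem_comap, Ideal.mem_span_singleton, coe_evalRingHom] at ha hb
    rw [derivative_mul, eval_add, eval_mul, eval_mul, eval_mul, pow_two]
    exact ⟨mul_dvd_mul ha hb, dvd_add (hb.mul_left _) (ha.mul_right _)⟩
  | add a _ b _ ha hb =>
    rw [derivative_add, eval_add, eval_add]
    exact ⟨dvd_add ha.1 hb.1, dvd_add ha.2 hb.2⟩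

theorem sq_dvd_discr_charpoly_add_scalar {R ι : Type*} [CommRing R] [Nontrivial R] [Fintype ι]
    [DecidableEq ι] {q l : R} {M : Matrix ι ι R} {r c : ι} (hrc : r ≠ c) (h0 : M r c = 0)
    (hr : ∀ j, q ∣ M r j) (hc : ∀ i, q ∣ M i c) :
    q ^ 2 ∣ (M + Matrix.scalar ι l).charpoly.discr := by
  set I := (Ideal.span {q}).comap (evalRingHom l)
  have hentry (i j : ι) (h : q ∣ M i j) : (M + Matrix.scalar ι l).charmatrix i j ∈ I := by
    rw [Ideal.mem_comap, Ideal.mem_span_singleton, coe_evalRingHom, Matrix.charmatrix_apply]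
    rcases eq_or_ne i j with rfl | hij
    · simpa using h
    · simpa [hij] using h
  have hmem : (M + Matrix.scalar ι l).charpoly ∈ I ^ 2 :=
    det_mem_sq I _ (by simp [hrc, h0])
      (fun j => hentry r j (hr j)) fun i => hentry i c (hc i)
  obtain ⟨heval, hderiv⟩ := sq_dvd_eval_and_dvd_eval_derivative hmem
  refine sq_dvd_discr (Matrix.charpoly_monic _) ?_ heval hderiv
  rw [Matrix.charpoly_natDegree_eq_dim]
  exact Fintype.one_lt_card_iff.2 ⟨r, c, hrc⟩

theorem matDisc_map_add_smul_antiDiag {R : Type*} [CommRing R] [Algebra R ℚ] {n : ℕ}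
    (hn : n ≠ 0) (B : Matrix (Fin n) (Fin n) R) (l : R) :
    matDisc (B.map (algebraMap R ℚ) + algebraMap R ℚ l • antiDiag n) =
      algebraMap R ℚ (B.submatrix Fin.rev id + Matrix.scalar (Fin n) l).charpoly.discr := by
  have : Nontrivial R := (algebraMap R ℚ).domain_nontrivial
  have hdeg : 0 < (B.submatrix Fin.rev id + Matrix.scalar (Fin n) l).charpoly.natDegree := by
    rw [Matrix.charpoly_natDegree_eq_dim, Fintype.card_fin]
    exact Nat.pos_of_ne_zero hn
  rw [← discr_map _ (Matrix.charpoly_monic _) hdeg, ← Matrix.charpoly_map, matDisc,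
    invPoly_eq_charpoly, antiDiag_mul_add_smul, Matrix.map_add _ (map_add _),
    Matrix.scalar_apply, Matrix.scalar_apply, Matrix.diagonal_map (map_zero _)]
  rfl

/-- The local ring `ℤ_(p)`, realised inside the rational numbers. -/
abbrev localIntegers (p : ℕ) [hp : Fact p.Prime] : Subalgebra ℤ ℚ :=
  have : (Ideal.span {(p : ℤ)}).IsPrime :=
    (Ideal.span_singleton_prime (mod_cast hp.out.ne_zero)).2 (Nat.prime_iff_prime_int.1 hp.out)
  Localization.subalgebra.ofField ℚ (Ideal.span {(p : ℤ)}).primeCompl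
    (Ideal.primeCompl_le_nonZeroDivisors _)

section LocalIntegers

variable {p : ℕ} [hp : Fact p.Prime]

theorem mem_localIntegers_iff {r : ℚ} :
    r ∈ localIntegers p ↔ ∃ a b : ℤ, ¬ (p : ℤ) ∣ b ∧ (b : ℚ) * r = a := by
  refine exists_congr fun a => exists_congr fun b => ?_
  rw [exists_prop, Ideal.mem_primeCompl_iff, Ideal.mem_span_singleton]
  refine and_congr_right fun hb => ?_
  have hb0 : (b : ℚ) ≠ 0 := Int.cast_ne_zero.2 (by rintro rfl; exact hb (dvd_zero _))
  rw [eq_intCast, eq_intCast, eq_mul_inv_iff_mul_eq₀ hb0, mul_comm]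

theorem SqDvdAt.of_dvd {r : localIntegers p} (h : (p : localIntegers p) ^ 2 ∣ r) :
    SqDvdAt p r := by
  obtain ⟨s, rfl⟩ := h
  obtain ⟨a, b, hb, hab⟩ := mem_localIntegers_iff.1 s.2
  refine ⟨a, b, hb, ?_⟩
  rw [← hab]
  push_cast
  ring

theorem exists_map_eq_of_mem_W0Lattice {g n d : ℕ} (hd : ¬ p ∣ d) {B : Matrix (Fin n) (Fin n) ℚ}
    (hB : B ∈ W0Lattice g n d) :
    ∃ B₀ : Matrix (Fin n) (Fin n) (localIntegers p), B₀.map (algebraMap _ ℚ) = B := by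
  have hmem (i j : Fin n) : B i j ∈ localIntegers p :=
    have ⟨z, hz⟩ := hB.2 i j
    mem_localIntegers_iff.2 ⟨z, d, mod_cast hd, hz⟩
  exact ⟨Matrix.of fun i j => ⟨B i j, hmem i j⟩, rfl⟩

theorem sqDvdAt_matDisc {n : ℕ} {B : Matrix (Fin n) (Fin n) (localIntegers p)} (hB : B.IsSymm)
    {r : Fin n} (hr : r.rev ≠ r) (h0 : B r r = 0) (hdvd : ∀ j, (p : localIntegers p) ∣ B r j)
    (l : ℤ) : SqDvdAt p (matDisc (B.map (algebraMap _ ℚ) + (l : ℚ) • antiDiag n)) := by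
  have := matDisc_map_add_smul_antiDiag (Fin.pos r).ne' B l
  rw [map_intCast] at this
  rw [this]
  refine SqDvdAt.of_dvd (sq_dvd_discr_charpoly_add_scalar hr ?_ (fun j => ?_) fun i => ?_)
  · rw [Matrix.submatrix_apply, Fin.rev_rev, id, h0]
  · rw [Matrix.submatrix_apply, Fin.rev_rev]
    exact hdvd _
  · rw [Matrix.submatrix_apply, id, hB.apply]
    exact hdvd _

theorem stronglyDvdMatDisc {g n d : ℕ} (hd : ¬ p ∣ d) {B : Matrix (Fin n) (Fin n) ℚ}
    (hB : B ∈ W0Lattice g n d) {r : Fin n} (hrg : r.val < g) (hrn : r.val + (g + 1) < n)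
    (hdvd : ∀ j, ∃ z : ℤ, B r j = p * z) (l : ℤ) :
    StronglyDvdMatDisc (W0Lattice g n d) p (B + (l : ℚ) • antiDiag n) := by
  have hinj : Function.Injective (algebraMap (localIntegers p) ℚ) := Subtype.val_injective
  have key (B' : Matrix (Fin n) (Fin n) ℚ) (hB' : B' ∈ W0Lattice g n d) :
      SqDvdAt p (matDisc (B + (l : ℚ) • antiDiag n + (p : ℚ) • B')) := by
    obtain ⟨B₀, rfl⟩ := exists_map_eq_of_mem_W0Lattice hd hB
    obtain ⟨B₁, rfl⟩ := exists_map_eq_of_mem_W0Lattice hd hB'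
    have hmap : B₀.map (algebraMap (localIntegers p) ℚ) +
        (p : ℚ) • B₁.map (algebraMap (localIntegers p) ℚ) =
        (B₀ + (p : localIntegers p) • B₁).map (algebraMap _ ℚ) := by
      ext i j
      simp
    have hrow (j : Fin n) : (p : localIntegers p) ∣ B₀ r j := by
      obtain ⟨z, hz⟩ := hdvd j
      exact ⟨z, hinj (by rw [map_mul, map_natCast, map_intCast]; exact hz)⟩
    have hzero {A : Matrix (Fin n) (Fin n) (localIntegers p)}
        (hA : A.map (algebraMap _ ℚ) ∈ W0Lattice g n d) : A r r = 0 :=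
      hinj ((hA.1.2 r r hrg hrn).trans (map_zero _).symm)
    have hsymm {A : Matrix (Fin n) (Fin n) (localIntegers p)}
        (hA : A.map (algebraMap _ ℚ) ∈ W0Lattice g n d) : A.IsSymm :=
      Matrix.IsSymm.ext fun i j => hinj (hA.1.1.apply i j)
    rw [add_right_comm, hmap]
    refine sqDvdAt_matDisc ((hsymm hB).add ((hsymm hB').smul _)) (r := r) ?_ ?_
      (fun j => dvd_add (hrow j) (dvd_mul_right _ _)) l
    · rw [Ne, Fin.ext_iff, Fin.val_rev]
      lia
    · rw [Matrix.add_apply, Matrix.smul_apply, hzero hB, hzero hB', smul_zero, add_zero]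
  have h0 : (0 : Matrix (Fin n) (Fin n) ℚ) ∈ W0Lattice g n d :=
    ⟨⟨Matrix.isSymm_zero, fun _ _ _ _ => rfl⟩, fun _ _ => ⟨0, by simp⟩⟩
  exact ⟨by simpa using key 0 h0, key⟩

end LocalIntegers

end StrongDivisibility

section BorderedDeterminant

open Matrix

theorem det_updateCol_mulVec {R ι : Type*} [CommRing R] [Fintype ι] [DecidableEq ι]
    (A : Matrix ι ι R) (k : ι) (w : ι → R) : (A.updateCol k (A *ᵥ w)).det = w k * A.det := by
  rw [← cramer_apply, cramer_eq_adjugate_mulVec, mulVec_mulVec, adjugate_mul, smul_mulVec,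
    one_mulVec, Pi.smul_apply, smul_eq_mul, mul_comm]

variable {R : Type*} [CommRing R] {g : ℕ}

theorem mul_det_vecCons_of_mulVec_eq_zero {T : Matrix (Fin g) (Fin (g + 1)) R}
    {w : Fin (g + 1) → R} (h : T *ᵥ w = 0) (b : Fin (g + 1) → R) (j : Fin (g + 1)) :
    w j * (of (vecCons b (of.symm T))).det =
      (b ⬝ᵥ w) * ((-1) ^ j.val * (T.submatrix id j.succAbove).det) := by
  have hmul : of (vecCons b (of.symm T)) *ᵥ w = vecCons (b ⬝ᵥ w) 0 := by
    rw [cons_mulVec, of.apply_symm_apply, h]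
  rw [← det_updateCol_mulVec, hmul, det_succ_column _ j, Finset.sum_eq_single 0]
  · have hsub : ((of (vecCons b (of.symm T))).updateCol j (vecCons (b ⬝ᵥ w) 0)).submatrix
        (Fin.succAbove 0) j.succAbove = T.submatrix id j.succAbove := by
      rw [submatrix_updateCol_succAbove, Fin.succAbove_zero]
      rfl
    rw [hsub, updateCol_self, cons_val_zero, Fin.val_zero, zero_add]
    ring
  · intro i _ hi
    obtain ⟨k, rfl⟩ := Fin.exists_succ_eq.2 hi
    rw [updateCol_self, cons_val_succ, Pi.zero_apply, mul_zero, zero_mul]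
  · simp

theorem mul_signed_minor_eq_of_mulVec_eq_zero {T : Matrix (Fin g) (Fin (g + 1)) R}
    {w : Fin (g + 1) → R} (h : T *ᵥ w = 0) (i j : Fin (g + 1)) :
    w j * ((-1) ^ i.val * (T.submatrix id i.succAbove).det) =
      w i * ((-1) ^ j.val * (T.submatrix id j.succAbove).det) := by
  have hdet : (of (vecCons (Pi.single i 1) (of.symm T))).det =
      (-1) ^ i.val * (T.submatrix id i.succAbove).det := by
    rw [det_succ_row_zero, Finset.sum_eq_single i]
    · have hsub : (of (vecCons (Pi.single i 1) (of.symm T))).submatrix Fin.succ i.succAbove =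
          T.submatrix id i.succAbove := rfl
      rw [hsub, of_apply, cons_val_zero, Pi.single_eq_same, mul_one]
    · intro k _ hk
      rw [of_apply, cons_val_zero, Pi.single_eq_of_ne hk, mul_zero, zero_mul]
    · simp
  rw [← hdet, mul_det_vecCons_of_mulVec_eq_zero h, single_one_dotProduct]

theorem det_fromBlocks_zero_mul {κ ι : Type*} [Fintype κ] [DecidableEq κ] [Fintype ι]
    [DecidableEq ι] {Q : Matrix κ ι R} {S : Matrix ι κ R} (hQS : Q * S = 1) (A : Matrix κ κ R)
    (C : Matrix ι κ R) (D : Matrix ι ι R) :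
    (fromBlocks 0 (A * Q) C D).det = A.det * (D * (1 - S * Q) - C * Q).det := by
  have hmul : fromBlocks 0 (A * Q) C D * fromBlocks 1 0 S 1 * fromBlocks 1 (-Q) 0 1 =
      fromBlocks A 0 (C + D * S) (D * (1 - S * Q) - C * Q) := by
    simp only [fromBlocks_multiply, Matrix.mul_zero, Matrix.mul_one, zero_add,
      add_zero, Matrix.mul_assoc, hQS, Matrix.mul_neg, neg_add_cancel, Matrix.mul_sub,
      Matrix.add_mul]
    congr 1
    abel
  rw [← det_fromBlocks_zero₁₂, ← hmul, det_mul, det_mul, det_fromBlocks_zero₁₂,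
    det_fromBlocks_zero₂₁]
  simp only [det_one, mul_one]

/-- The `g × (g + 1)` matrix of the projection that forgets the coordinate `0`. -/
def tailMatrix (R : Type*) [CommRing R] (g : ℕ) : Matrix (Fin g) (Fin (g + 1)) R :=
  of fun i k => if k = i.succ then 1 else 0

theorem mul_tailMatrix_zero {κ : Type*} (A : Matrix κ (Fin g) R) (i : κ) :
    (A * tailMatrix R g) i 0 = 0 := by
  simp [mul_apply, tailMatrix, (Fin.succ_ne_zero _).symm]

theorem mul_tailMatrix_succ {κ : Type*} (A : Matrix κ (Fin g) R) (i : κ) (k : Fin g) :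
    (A * tailMatrix R g) i k.succ = A i k := by
  simp [mul_apply, tailMatrix]

theorem mul_transpose_tailMatrix {κ : Type*} (A : Matrix κ (Fin (g + 1)) R) :
    A * (tailMatrix R g)ᵀ = A.submatrix id Fin.succ := by
  ext i k
  simp [mul_apply, tailMatrix]

theorem sq_mul_det_fromBlocks_zero {T : Matrix (Fin g) (Fin (g + 1)) R}
    {w : Fin (g + 1) → R} (h : T *ᵥ w = 0) (D : Matrix (Fin (g + 1)) (Fin (g + 1)) R) :
    w 0 ^ 2 * (fromBlocks 0 T Tᵀ D).det =
      (-1) ^ g * (T.submatrix id Fin.succ).det ^ 2 * (w ⬝ᵥ D *ᵥ w) := by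
  have hQS : tailMatrix R g * (tailMatrix R g)ᵀ = 1 := by
    rw [mul_transpose_tailMatrix]
    ext i k
    simp [tailMatrix, one_apply, eq_comm]
  have hcol : (fromBlocks 0 T Tᵀ D).updateCol (Sum.inr 0)
      (fromBlocks 0 T Tᵀ D *ᵥ Sum.elim 0 w) =
      fromBlocks 0 (T.submatrix id Fin.succ * tailMatrix R g) Tᵀ (D.updateCol 0 (D *ᵥ w)) := by
    rw [fromBlocks_mulVec]
    simp only [Sum.elim_comp_inl, Sum.elim_comp_inr, mulVec_zero, zero_add, h]
    ext (i | i) (j | j)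
    · simp
    · cases j using Fin.cases <;> simp [mul_tailMatrix_zero, mul_tailMatrix_succ]
    · simp
    · cases j using Fin.cases <;> simp
  have hrest : D.updateCol 0 (D *ᵥ w) * (1 - (tailMatrix R g)ᵀ * tailMatrix R g) -
      Tᵀ * tailMatrix R g = (of (vecCons (D *ᵥ w) (of.symm (-T))))ᵀ := by
    rw [Matrix.mul_sub, Matrix.mul_one, ← Matrix.mul_assoc, mul_transpose_tailMatrix]
    ext i k
    cases k using Fin.cases <;> simp [mul_tailMatrix_zero, mul_tailMatrix_succ]
  have hneg : (-T) *ᵥ w = 0 := by rw [neg_mulVec, h, neg_zero]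
  have hminor := mul_det_vecCons_of_mulVec_eq_zero hneg (D *ᵥ w) 0
  have hdet := det_updateCol_mulVec (fromBlocks 0 T Tᵀ D) (Sum.inr 0) (Sum.elim 0 w)
  have hsub : (-T).submatrix id Fin.succ = -T.submatrix id Fin.succ := rfl
  rw [hcol, det_fromBlocks_zero_mul hQS, hrest, det_transpose, Sum.elim_inr] at hdet
  rw [pow_two, mul_assoc, ← hdet, mul_left_comm, hminor, Fin.val_zero, pow_zero, one_mul,
    Fin.succAbove_zero, hsub, det_neg, Fintype.card_fin, dotProduct_comm]
  ring

theorem det_eq_neg_det_of_pivot {ι κ : Type*} [Fintype ι] [DecidableEq ι]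
    [Fintype κ] [DecidableEq κ] (e : Fin 1 ⊕ ι ≃ κ) {M : Matrix κ κ R}
    (hM : M (e (.inl 0)) (e (.inl 0)) = -1) :
    M.det = -(of fun i j => M (e (.inr i)) (e (.inr j)) +
      M (e (.inr i)) (e (.inl 0)) * M (e (.inl 0)) (e (.inr j))).det := by
  have hpivot : (M.submatrix e e).toBlocks₁₁ = -1 := by
    ext i j
    rw [Subsingleton.elim i 0, Subsingleton.elim j 0]
    exact hM
  let : Invertible (1 : Matrix (Fin 1) (Fin 1) R) := invertibleOne
  let : Invertible (-1 : Matrix (Fin 1) (Fin 1) R) := invertibleNeg 1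
  rw [← det_submatrix_equiv_self e, ← fromBlocks_toBlocks (M.submatrix e e), hpivot,
    det_fromBlocks₁₁, invOf_neg, invOf_one, det_fin_one, Matrix.mul_neg, Matrix.mul_one,
    Matrix.neg_mul, sub_neg_eq_add, Matrix.neg_apply, one_apply_eq, neg_one_mul]
  congr 2
  ext i j
  simp [mul_apply, toBlocks₂₂, toBlocks₂₁, toBlocks₁₂]

end BorderedDeterminant

section PencilBlock

open Matrix

variable {R : Type*} [CommRing R] (g : ℕ) (x m : R)

/-- The top right `g × (g + 1)` block of `A₀ x - B` for the matrices `B = B_m(c₁, …, c_n)`. -/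
def pencilBlock : Matrix (Fin g) (Fin (g + 1)) R :=
  of fun i j =>
    (if j = i.rev.succ then x else 0) - if j = i.rev.castSucc then if i.val = 0 then m else 1 else 0

/-- The vector `(x ^ g, …, x, m)`, which spans the kernel of `pencilBlock g x m` generically. -/
def kernelVector (k : Fin (g + 1)) : R :=
  if k = Fin.last g then m else x ^ k.rev.val

theorem kernelVector_castSucc (k : Fin g) :
    kernelVector g x m k.castSucc = x ^ (k.rev.val + 1) := by
  rw [kernelVector, if_neg k.castSucc_ne_last, Fin.rev_castSucc, Fin.val_succ]

theorem kernelVector_last : kernelVector g x m (Fin.last g) = m := if_pos rfl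

theorem pencilBlock_mulVec_kernelVector : pencilBlock g x m *ᵥ kernelVector g x m = 0 := by
  ext i
  have hmul : (pencilBlock g x m *ᵥ kernelVector g x m) i =
      x * kernelVector g x m i.rev.succ -
        (if i.val = 0 then m else 1) * kernelVector g x m i.rev.castSucc := by
    simp [pencilBlock, mulVec, dotProduct, sub_mul, Finset.sum_sub_distrib]
  rw [hmul, kernelVector_castSucc, Fin.rev_rev, Pi.zero_apply]
  by_cases hi : i.val = 0
  · have hlast : i.rev.succ = Fin.last g := by
      rw [Fin.ext_iff, Fin.val_succ, Fin.val_rev, Fin.val_last]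
      lia
    rw [if_pos hi, hlast, kernelVector_last, hi]
    ring
  · have hlast : i.rev.succ ≠ Fin.last g := by
      rw [Ne, Fin.ext_iff, Fin.val_succ, Fin.val_rev, Fin.val_last]
      lia
    rw [if_neg hi, kernelVector, if_neg hlast, Fin.rev_succ, Fin.rev_rev, Fin.val_castSucc]
    ring

theorem det_pencilBlock_submatrix_succ :
    ((pencilBlock g x m).submatrix id Fin.succ).det = (-1) ^ (g * (g - 1) / 2) * x ^ g := by
  rw [det_of_antitriangular]
  · simp [pencilBlock, Fin.ext_iff]
  · intro i j hij
    simp only [pencilBlock, submatrix_apply, of_apply, id, Fin.ext_iff, Fin.val_succ,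
      Fin.val_castSucc, Fin.val_rev]
    rw [if_neg (by lia), if_neg (by lia), sub_zero]

variable {g x}

theorem kernelVector_zero (hg : g ≠ 0) : kernelVector g x m 0 = x ^ g := by
  rw [kernelVector, if_neg (by simpa [Fin.ext_iff] using hg.symm), Fin.rev_zero, Fin.val_last]

variable [IsDomain R]

theorem det_fromBlocks_pencilBlock (hg : g ≠ 0) (hx : x ≠ 0)
    (D : Matrix (Fin (g + 1)) (Fin (g + 1)) R) :
    (fromBlocks 0 (pencilBlock g x m) (pencilBlock g x m)ᵀ D).det =
      (-1) ^ g * (kernelVector g x m ⬝ᵥ D *ᵥ kernelVector g x m) := by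
  have hdet := sq_mul_det_fromBlocks_zero (pencilBlock_mulVec_kernelVector g x m) D
  rw [kernelVector_zero m hg, det_pencilBlock_submatrix_succ, mul_pow, pow_right_comm (-1),
    neg_one_sq, one_pow, one_mul, mul_comm (_ ^ g), mul_assoc] at hdet
  exact mul_left_cancel₀ (pow_ne_zero _ (pow_ne_zero _ hx)) hdet

theorem signed_minor_pencilBlock (hg : g ≠ 0) (hx : x ≠ 0) (k : Fin (g + 1)) :
    (-1) ^ k.val * ((pencilBlock g x m).submatrix id k.succAbove).det =
      (-1) ^ (g * (g - 1) / 2) * kernelVector g x m k := by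
  have hminor := mul_signed_minor_eq_of_mulVec_eq_zero (pencilBlock_mulVec_kernelVector g x m) k 0
  rw [kernelVector_zero m hg, Fin.succAbove_zero, det_pencilBlock_submatrix_succ, Fin.val_zero,
    pow_zero, one_mul] at hminor
  refine mul_left_cancel₀ (pow_ne_zero g hx) (hminor.trans ?_)
  ring

end PencilBlock

section Tridiagonal

open Matrix

variable {R : Type*} [CommRing R]

/-- The matrix of size `N + 1` with entries `e 0, …, e (N - 1)` just above the diagonal. -/
def superdiagonal (N : ℕ) (e : ℕ → R) : Matrix (Fin (N + 1)) (Fin (N + 1)) R :=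
  of fun i j => if j.val = i.val + 1 then e i.val else 0

/-- The symmetric tridiagonal matrix of size `N + 1` with diagonal entries `d 0, …, d N` and
off-diagonal entries `e 0, …, e (N - 1)`. -/
def tridiagonal (N : ℕ) (d e : ℕ → R) : Matrix (Fin (N + 1)) (Fin (N + 1)) R :=
  diagonal (fun i : Fin (N + 1) => d i.val) + superdiagonal N e + (superdiagonal N e)ᵀ

theorem tridiagonal_apply (N : ℕ) (d e : ℕ → R) (i j : Fin (N + 1)) :
    tridiagonal N d e i j =
      if i.val = j.val then d i
      else if j.val = i.val + 1 then e i
      else if i.val = j.val + 1 then e j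
      else 0 := by
  simp only [tridiagonal, superdiagonal, of_apply, Matrix.add_apply, transpose_apply,
    diagonal_apply, Fin.ext_iff]
  split_ifs <;> first | lia | simp

theorem dotProduct_superdiagonal_mulVec (N : ℕ) (e : ℕ → R) (v : Fin (N + 1) → R) :
    v ⬝ᵥ superdiagonal N e *ᵥ v = ∑ i : Fin N, e i.val * (v i.castSucc * v i.succ) := by
  have hlast : (superdiagonal N e *ᵥ v) (Fin.last N) = 0 := by
    simp [superdiagonal, mulVec, dotProduct, (Fin.is_lt _).ne]
  have hcastSucc (i : Fin N) : (superdiagonal N e *ᵥ v) i.castSucc = e i.val * v i.succ := by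
    have hiff (j : Fin (N + 1)) : j.val = i.val + 1 ↔ j = i.succ := by
      rw [Fin.ext_iff, Fin.val_succ]
    simp [superdiagonal, mulVec, dotProduct, hiff]
  rw [dotProduct, Fin.sum_univ_castSucc, hlast, mul_zero, add_zero]
  exact Finset.sum_congr rfl fun i _ => by rw [hcastSucc, mul_left_comm]

theorem dotProduct_tridiagonal_mulVec (N : ℕ) (d e : ℕ → R) (v : Fin (N + 1) → R) :
    v ⬝ᵥ tridiagonal N d e *ᵥ v =
      ∑ i, d i.val * v i ^ 2 + 2 * ∑ i : Fin N, e i.val * (v i.castSucc * v i.succ) := by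
  have hdiag : v ⬝ᵥ diagonal (fun i : Fin (N + 1) => d i.val) *ᵥ v = ∑ i, d i.val * v i ^ 2 :=
    Finset.sum_congr rfl fun i _ => by
      rw [mulVec_diagonal]
      ring
  rw [tridiagonal, add_mulVec, add_mulVec, dotProduct_add, dotProduct_add, hdiag,
    mulVec_transpose, dotProduct_comm v (v ᵥ* _), ← dotProduct_mulVec,
    dotProduct_superdiagonal_mulVec]
  ring

theorem sum_range_two_mul_add_one {M : Type*} [AddCommMonoid M] (F : ℕ → M) (n : ℕ) :
    ∑ i ∈ Finset.range (2 * n + 1), F i =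
      ∑ k ∈ Finset.range (n + 1), F (2 * k) + ∑ k ∈ Finset.range n, F (2 * k + 1) := by
  induction n with
  | zero => simp
  | succ n ih =>
    rw [show 2 * (n + 1) + 1 = 2 * n + 1 + 1 + 1 by ring, Finset.sum_range_succ,
      Finset.sum_range_succ, ih, Finset.sum_range_succ _ (n + 1),
      Finset.sum_range_succ (fun k => F (2 * k + 1)) n, mul_add_one]
    abel

theorem sum_mul_kernelVector_sq (g : ℕ) (x m : R) (d : ℕ → R) :
    ∑ i : Fin (g + 1), d i.val * kernelVector g x m i ^ 2 =
      ∑ k ∈ Finset.range g, d k * x ^ (2 * g - 2 * k) + d g * m ^ 2 := by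
  rw [Fin.sum_univ_castSucc, kernelVector_last, Fin.val_last, Finset.sum_range]
  congr 1
  refine Finset.sum_congr rfl fun i _ => ?_
  rw [kernelVector_castSucc, ← pow_mul, Fin.val_rev, Fin.val_castSucc]
  congr 2
  lia

theorem sum_mul_kernelVector_mul_succ (h : ℕ) (x m : R) (e : ℕ → R) :
    ∑ i : Fin (h + 1), e i.val *
        (kernelVector (h + 1) x m i.castSucc * kernelVector (h + 1) x m i.succ) =
      ∑ k ∈ Finset.range h, e k * x ^ (2 * h + 2 - (2 * k + 1)) + e h * (x * m) := by
  rw [Fin.sum_univ_castSucc, Fin.succ_last, kernelVector_last, kernelVector_castSucc, Fin.rev_last,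
    Fin.val_last, Fin.val_zero, zero_add, pow_one, Finset.sum_range]
  congr 1
  refine Finset.sum_congr rfl fun i _ => ?_
  rw [Fin.succ_castSucc, kernelVector_castSucc, kernelVector_castSucc, ← pow_add, Fin.val_rev,
    Fin.val_rev, Fin.val_castSucc, Fin.val_succ]
  congr 2
  lia

theorem dotProduct_tridiagonal_mulVec_kernelVector (h : ℕ) (x m t : R) {a d e : ℕ → R}
    (hd : ∀ k, d k = a (2 * k) + if k = 0 then t else 0) (he : ∀ k, 2 * e k = a (2 * k + 1)) :
    kernelVector (h + 1) x m ⬝ᵥ tridiagonal (h + 1) d e *ᵥ kernelVector (h + 1) x m =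
      t * x ^ (2 * h + 2) + ∑ i ∈ Finset.range (2 * h + 1), a i * x ^ (2 * h + 2 - i) +
        m * a (2 * h + 1) * x + m ^ 2 * a (2 * h + 2) := by
  have hstart : ∑ k ∈ Finset.range (h + 1), (if k = 0 then t else 0) * x ^ (2 * h + 2 - 2 * k) =
      t * x ^ (2 * h + 2) := by
    simp
  rw [dotProduct_tridiagonal_mulVec, sum_mul_kernelVector_sq, sum_mul_kernelVector_mul_succ,
    sum_range_two_mul_add_one]
  simp only [hd, mul_add_one 2 h, add_mul, Finset.sum_add_distrib, hstart, mul_add (2 : R),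
    Finset.mul_sum, ← mul_assoc, he, Nat.succ_ne_zero, if_false]
  ring

end Tridiagonal

section ExplicitMatrices

open Matrix

variable {n g m : ℕ}

/-- The matrix `A₀ x - B`, whose determinant is `invPoly B` up to sign. -/
def pencil (B : Matrix (Fin n) (Fin n) ℚ) : Matrix (Fin n) (Fin n) ℚ[X] :=
  (X : ℚ[X]) • (antiDiag n).map C - B.map C

theorem pencil_apply (B : Matrix (Fin n) (Fin n) ℚ) (i j : Fin n) :
    pencil B i j = (if i.val + j.val + 1 = n then X else 0) - C (B i j) := by
  simp only [pencil, Matrix.sub_apply, Matrix.smul_apply, Matrix.map_apply, antiDiag, of_apply]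
  split_ifs <;> simp

theorem isSymm_pencil {B : Matrix (Fin n) (Fin n) ℚ} (hB : B.IsSymm) : (pencil B).IsSymm :=
  ((isSymm_antiDiag n).map _ |>.smul _).sub (hB.map _)

/-- The first `g` rows of `B` are those of the matrices `B_m(c₁, …, c_n)`, which do not depend on
`c₁, …, c_n`. -/
def HasNormalTopRows (g m : ℕ) (B : Matrix (Fin n) (Fin n) ℚ) : Prop :=
  ∀ i j : Fin n, i.val < g →
    B i j = if i.val + j.val + 2 = n then if i.val = 0 then (m : ℚ) else 1 else 0

theorem HasNormalTopRows.pencil_apply_eq_zero {B : Matrix (Fin n) (Fin n) ℚ}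
    (hB : HasNormalTopRows g m B) {i j : Fin n} (hi : i.val < g) (hj : i.val + j.val + 2 < n) :
    pencil B i j = 0 := by
  rw [pencil_apply, hB i j hi, if_neg (by lia), if_neg (by lia), map_zero, sub_zero]

theorem HasNormalTopRows.pencil_apply_eq_pencilBlock {B : Matrix (Fin n) (Fin n) ℚ}
    (hB : HasNormalTopRows g m B) {i j : Fin n} {a : Fin g} {b : Fin (g + 1)}
    (hi : i.val = a.val) (hj : j.val + (g + 1) = n + b.val) :
    pencil B i j = pencilBlock g X (C (m : ℚ)) a b := by
  rw [pencil_apply, hB i j (hi.trans_lt a.isLt)]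
  simp only [pencilBlock, of_apply, Fin.ext_iff, Fin.val_succ, Fin.val_castSucc, Fin.val_rev, hi]
  split_ifs <;> first | lia | simp

section Odd

variable (g m) (c : ℕ → ℤ)

theorem isSymm_oddMatrix : (oddMatrix g m c).IsSymm := by
  ext i j
  simp only [oddMatrix, transpose_apply, of_apply, min_comm, max_comm]

theorem hasNormalTopRows_oddMatrix : HasNormalTopRows g m (oddMatrix g m c) := by
  intro i j hi
  simp only [oddMatrix, of_apply]
  split_ifs <;> first | rfl | lia

theorem pencil_oddMatrix_apply_tridiagonal {i j : Fin (2 * g + 1)} {a b : Fin (g + 1)}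
    (hi : i.val = g + a.val) (hj : j.val = g + b.val) :
    pencil (oddMatrix g m c) i j =
      tridiagonal g (fun k => C (c (2 * k + 1) : ℚ) + if k = 0 then X else 0)
        (fun k => C ((c (2 * k + 2) : ℚ) / 2)) a b := by
  rw [tridiagonal_apply, pencil_apply]
  simp only [oddMatrix, of_apply, hi, hj, Nat.add_min_add_left, Nat.add_max_add_left,
    Nat.add_sub_cancel_left, Nat.le_add_right, and_true, add_assoc, Nat.add_left_cancel_iff]
  rcases lt_trichotomy a.val b.val with hab | hab | hab
  · simp only [min_eq_left hab.le, max_eq_right hab.le, hab.ne, if_false]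
    split_ifs <;> first | lia | simp [neg_div]
  · simp only [hab, min_self, max_self, if_true]
    split_ifs <;> first | lia | simp [add_comm]
  · simp only [min_eq_right hab.le, max_eq_left hab.le, hab.ne, hab.ne', if_false]
    split_ifs <;> first | lia | simp [neg_div]

/-- The splitting of the indices of a matrix of size `2 g + 1` as `0, …, g - 1` and
`g, …, 2 g`. -/
def oddIndexEquiv : Fin g ⊕ Fin (g + 1) ≃ Fin (2 * g + 1) :=
  finSumFinEquiv.trans (finCongr (by ring))

theorem pencil_oddMatrix_submatrix :
    (pencil (oddMatrix g m c)).submatrix (oddIndexEquiv g) (oddIndexEquiv g) =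
      fromBlocks 0 (pencilBlock g X (C (m : ℚ))) (pencilBlock g X (C (m : ℚ)))ᵀ
        (tridiagonal g (fun k => C (c (2 * k + 1) : ℚ) + if k = 0 then X else 0)
          fun k => C ((c (2 * k + 2) : ℚ) / 2)) := by
  have hB := hasNormalTopRows_oddMatrix g m c
  have hinl (i : Fin g) : (oddIndexEquiv g (.inl i)).val = i.val := by simp [oddIndexEquiv]
  have hinr (i : Fin (g + 1)) : (oddIndexEquiv g (.inr i)).val = g + i.val := by
    simp [oddIndexEquiv]
  have htop (i : Fin g) (j : Fin (g + 1)) : pencil (oddMatrix g m c) (oddIndexEquiv g (.inl i))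
      (oddIndexEquiv g (.inr j)) = pencilBlock g X (C (m : ℚ)) i j :=
    hB.pencil_apply_eq_pencilBlock (hinl i) (by rw [hinr]; ring)
  refine Matrix.ext fun i j => ?_
  rcases i with i | i <;> rcases j with j | j
  · exact hB.pencil_apply_eq_zero ((hinl i).trans_lt i.isLt) (by rw [hinl, hinl]; lia)
  · exact htop i j
  · exact ((isSymm_pencil (isSymm_oddMatrix g m c)).apply _ _).trans (htop j i)
  · exact pencil_oddMatrix_apply_tridiagonal g m c (hinr i) (hinr j)

variable {g}

theorem invPoly_oddMatrix (hg : 1 ≤ g) :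
    invPoly (oddMatrix g m c) = (normalForm (2 * g + 1) m c).map (Int.castRingHom ℚ) := by
  obtain ⟨h, rfl⟩ := Nat.exists_eq_add_of_le' hg
  have hsign : (-1 : ℚ[X]) ^ ((2 * (h + 1) + 1) * (2 * (h + 1) + 1 - 1) / 2) *
      (-1) ^ (h + 1) = 1 := by
    have hexp : (2 * (h + 1) + 1) * (2 * (h + 1) + 1 - 1) / 2 = (2 * (h + 1) + 1) * (h + 1) := by
      rw [Nat.add_sub_cancel, mul_left_comm, Nat.mul_div_cancel_left _ two_pos]
    rw [hexp, ← pow_add, Even.neg_one_pow ⟨(h + 1) * (h + 2), by ring⟩]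
  have hdet := det_submatrix_equiv_self (oddIndexEquiv (h + 1)) (pencil (oddMatrix (h + 1) m c))
  rw [pencil_oddMatrix_submatrix, det_fromBlocks_pencilBlock _ h.succ_ne_zero X_ne_zero,
    dotProduct_tridiagonal_mulVec_kernelVector h X _ X (a := fun k => C (c (k + 1) : ℚ))
      (fun _ => rfl) (fun k => by rw [← C_ofNat, ← C_mul, mul_div_cancel₀ _ two_ne_zero])] at hdet
  rw [invPoly, ← pencil, ← hdet, ← mul_assoc, hsign, one_mul,
    show 2 * (h + 1) + 1 = 2 * h + 1 + 2 by ring, map_normalForm_add_two]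
  ring

end Odd

section Even

variable (g m) (c : ℕ → ℤ)

theorem isSymm_evenMatrix : (evenMatrix g m c).IsSymm := by
  ext i j
  simp only [evenMatrix, transpose_apply, of_apply, min_comm, max_comm]

theorem hasNormalTopRows_evenMatrix : HasNormalTopRows g m (evenMatrix g m c) := by
  intro i j hi
  simp only [evenMatrix, of_apply]
  split_ifs <;> first | rfl | lia

/-- The splitting of the indices of a matrix of size `2 g + 2` as the pivot `g`, followed by
`0, …, g - 1` and `g + 1, …, 2 g + 1`. -/
def evenIndexEquiv : Fin 1 ⊕ (Fin g ⊕ Fin (g + 1)) ≃ Fin (2 * g + 2) :=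
  (Equiv.sumAssoc _ _ _).symm.trans <|
    ((Equiv.sumComm _ _).trans finSumFinEquiv).sumCongr (Equiv.refl _) |>.trans <|
      finSumFinEquiv.trans (finCongr (by ring))

theorem evenIndexEquiv_inl (i : Fin 1) : (evenIndexEquiv g (.inl i)).val = g := by
  simp [evenIndexEquiv]

theorem evenIndexEquiv_inr_inl (i : Fin g) : (evenIndexEquiv g (.inr (.inl i))).val = i.val := by
  simp [evenIndexEquiv]

theorem evenIndexEquiv_inr_inr (i : Fin (g + 1)) :
    (evenIndexEquiv g (.inr (.inr i))).val = g + 1 + i.val := by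
  simp [evenIndexEquiv, add_comm]

variable {g}

theorem pencil_evenMatrix_pivot_row (hg : 1 ≤ g) {i : Fin (2 * g + 2)} (hi : i.val = g)
    (j : Fin (2 * g + 2)) :
    pencil (evenMatrix g m c) i j =
      if j.val = g then -1 else if j.val = g + 1 then X + C ((c 1 : ℚ) / 2) else 0 := by
  rw [pencil_apply]
  simp only [evenMatrix, of_apply, hi]
  rcases lt_trichotomy g j.val with hij | hij | hij
  · rw [min_eq_left hij.le, max_eq_right hij.le, Nat.sub_self]
    split_ifs <;> first | lia | simp [neg_div]
  · rw [← hij, min_self, max_self]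
    split_ifs <;> first | lia | simp
  · rw [min_eq_right hij.le, max_eq_left hij.le]
    split_ifs <;> first | lia | simp

theorem pencil_evenMatrix_apply_tridiagonal {i j : Fin (2 * g + 2)} {a b : Fin (g + 1)}
    (hi : i.val = g + 1 + a.val) (hj : j.val = g + 1 + b.val) :
    pencil (evenMatrix g m c) i j =
      tridiagonal g
        (fun k => C (c (2 * k + 2) : ℚ) - if k = 0 then C ((c 1 : ℚ) ^ 2 / 4) else 0)
        (fun k => C ((c (2 * k + 3) : ℚ) / 2)) a b := by
  have hsub (k : ℕ) : g + (1 + k) - g = k + 1 := by lia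
  rw [tridiagonal_apply, pencil_apply]
  simp only [evenMatrix, of_apply, hi, hj, Nat.add_min_add_left, Nat.add_max_add_left, add_assoc,
    Nat.add_left_cancel_iff, Nat.le_add_right, and_true, Nat.add_lt_add_iff_left, hsub, mul_add_one]
  rcases lt_trichotomy a.val b.val with hab | hab | hab
  · simp only [min_eq_left hab.le, max_eq_right hab.le, hab.ne, if_false]
    split_ifs <;> first | lia | simp [neg_div]
  · simp only [hab, min_self, max_self, if_true]
    split_ifs <;> first | lia | simp_all
  · simp only [min_eq_right hab.le, max_eq_left hab.le, hab.ne, hab.ne', if_false]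
    split_ifs <;> first | lia | simp [neg_div]

theorem X_add_C_half_mul_self (a : ℚ) :
    (X + C (a / 2)) * (X + C (a / 2)) = X ^ 2 + C a * X + C (a ^ 2 / 4) := by
  have hsq : C (a ^ 2 / 4) = C (a / 2) ^ 2 := by
    rw [← C_pow, div_pow]
    norm_num
  have htwo : C a = 2 * C (a / 2) := by
    rw [← C_ofNat, ← C_mul, mul_div_cancel₀ _ two_ne_zero]
  rw [hsq, htwo]
  ring

theorem pencil_evenMatrix_schurComplement (hg : 1 ≤ g) :
    (of fun i j => pencil (evenMatrix g m c) (evenIndexEquiv g (.inr i))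
        (evenIndexEquiv g (.inr j)) +
      pencil (evenMatrix g m c) (evenIndexEquiv g (.inr i)) (evenIndexEquiv g (.inl 0)) *
        pencil (evenMatrix g m c) (evenIndexEquiv g (.inl 0)) (evenIndexEquiv g (.inr j))) =
      fromBlocks 0 (pencilBlock g X (C (m : ℚ))) (pencilBlock g X (C (m : ℚ)))ᵀ
        (tridiagonal g
          (fun k => C (c (2 * k + 2) : ℚ) + if k = 0 then X ^ 2 + C (c 1 : ℚ) * X else 0)
          fun k => C ((c (2 * k + 3) : ℚ) / 2)) := by
  have hB := hasNormalTopRows_evenMatrix g m c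
  have hsymm := isSymm_pencil (isSymm_evenMatrix g m c)
  have hrow := pencil_evenMatrix_pivot_row m c hg (evenIndexEquiv_inl g 0)
  have hcorner (i : Fin (g + 1)) : pencil (evenMatrix g m c) (evenIndexEquiv g (.inl 0))
      (evenIndexEquiv g (.inr (.inr i))) = if i.val = 0 then X + C ((c 1 : ℚ) / 2) else 0 := by
    rw [hrow, evenIndexEquiv_inr_inr, if_neg (by lia)]
    simp only [add_eq_left]
  have htop (i : Fin g) (j : Fin (g + 1)) : pencil (evenMatrix g m c)
      (evenIndexEquiv g (.inr (.inl i))) (evenIndexEquiv g (.inr (.inr j))) =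
        pencilBlock g X (C (m : ℚ)) i j :=
    hB.pencil_apply_eq_pencilBlock (evenIndexEquiv_inr_inl g i)
      (by rw [evenIndexEquiv_inr_inr]; ring)
  have hzero (i : Fin g) : pencil (evenMatrix g m c) (evenIndexEquiv g (.inl 0))
      (evenIndexEquiv g (.inr (.inl i))) = 0 := by
    rw [hrow, evenIndexEquiv_inr_inl, if_neg i.isLt.ne, if_neg (by lia)]
  refine Matrix.ext fun i j => ?_
  rw [of_apply]
  rcases i with i | i <;> rcases j with j | j
  · rw [hzero, mul_zero, add_zero]
    exact hB.pencil_apply_eq_zero ((evenIndexEquiv_inr_inl g i).trans_lt i.isLt)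
      (by rw [evenIndexEquiv_inr_inl, evenIndexEquiv_inr_inl]; lia)
  · rw [(hsymm.apply _ _).trans (hzero i), zero_mul, add_zero]
    exact htop i j
  · rw [hzero, mul_zero, add_zero]
    exact (hsymm.apply _ _).trans (htop j i)
  · rw [(hsymm.apply _ _).trans (hcorner i), hcorner, fromBlocks_apply₂₂,
      pencil_evenMatrix_apply_tridiagonal m c (evenIndexEquiv_inr_inr g i)
        (evenIndexEquiv_inr_inr g j), tridiagonal_apply, tridiagonal_apply]
    split_ifs <;> first | lia | rw [X_add_C_half_mul_self]; ring | simp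

theorem invPoly_evenMatrix (hg : 1 ≤ g) :
    invPoly (evenMatrix g m c) = (normalForm (2 * g + 2) m c).map (Int.castRingHom ℚ) := by
  have hpivot : pencil (evenMatrix g m c) (evenIndexEquiv g (.inl 0)) (evenIndexEquiv g (.inl 0)) =
      -1 := by
    rw [pencil_evenMatrix_pivot_row m c hg (evenIndexEquiv_inl g 0), evenIndexEquiv_inl,
      if_pos rfl]
  obtain ⟨h, rfl⟩ := Nat.exists_eq_add_of_le' hg
  have hsign : (-1 : ℚ[X]) ^ ((2 * (h + 1) + 2) * (2 * (h + 1) + 2 - 1) / 2) *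
      (-1) ^ (h + 1) = -1 := by
    have hexp : (2 * (h + 1) + 2) * (2 * (h + 1) + 2 - 1) / 2 = (h + 2) * (2 * h + 3) := by
      rw [show 2 * (h + 1) + 2 = 2 * (h + 2) by ring, mul_assoc,
        Nat.mul_div_cancel_left _ two_pos]
      rfl
    rw [hexp, ← pow_add, Odd.neg_one_pow ⟨h ^ 2 + 4 * h + 3, by ring⟩]
  rw [invPoly, ← pencil, det_eq_neg_det_of_pivot _ hpivot,
    pencil_evenMatrix_schurComplement m c hg, det_fromBlocks_pencilBlock _ h.succ_ne_zero X_ne_zero,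
    dotProduct_tridiagonal_mulVec_kernelVector h X _ (X ^ 2 + C (c 1 : ℚ) * X)
      (a := fun k => C (c (k + 2) : ℚ))
      (fun _ => rfl) (fun k => by rw [← C_ofNat, ← C_mul, mul_div_cancel₀ _ two_ne_zero]),
    mul_neg, ← mul_assoc, hsign, neg_one_mul, neg_neg, map_normalForm_add_two,
    show 2 * (h + 1) = 2 * h + 1 + 1 by ring, Finset.sum_range_succ' _ (2 * h + 1)]
  simp only [Nat.reduceSubDiff, Nat.sub_zero, zero_add]
  ring

end Even

theorem HasNormalTopRows.mem_W0 {B : Matrix (Fin n) (Fin n) ℚ} (hB : HasNormalTopRows g m B)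
    (hsymm : B.IsSymm) : B ∈ W0 g n :=
  ⟨hsymm, fun i j hi hj => by rw [hB i j hi, if_neg (by lia)]⟩

theorem oddMatrix_mem_W0Lattice (g m : ℕ) (c : ℕ → ℤ) :
    oddMatrix g m c ∈ W0Lattice g (2 * g + 1) 2 := by
  refine ⟨(hasNormalTopRows_oddMatrix g m c).mem_W0 (isSymm_oddMatrix g m c), fun i j => ?_⟩
  simp only [oddMatrix, of_apply]
  set a := min i.val j.val
  split_ifs
  · exact ⟨2 * m, by push_cast; ring⟩
  · exact ⟨2, by push_cast; ring⟩
  · exact ⟨-2 * c (2 * (a - g) + 1), by push_cast; ring⟩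
  · exact ⟨-c (2 * (a - g) + 2), by push_cast; ring⟩
  · exact ⟨0, by push_cast; ring⟩

theorem evenMatrix_mem_W0Lattice (g m : ℕ) (c : ℕ → ℤ) :
    evenMatrix g m c ∈ W0Lattice g (2 * g + 2) 4 := by
  refine ⟨(hasNormalTopRows_evenMatrix g m c).mem_W0 (isSymm_evenMatrix g m c), fun i j => ?_⟩
  simp only [evenMatrix, of_apply]
  set a := min i.val j.val
  split_ifs
  · exact ⟨4 * m, by push_cast; ring⟩
  · exact ⟨4, by push_cast; ring⟩
  · exact ⟨c 1 ^ 2 - 4 * c 2, by push_cast; ring⟩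
  · exact ⟨-4 * c (2 * (a - g)), by push_cast; ring⟩
  · exact ⟨-2 * c (2 * (a - g) + 1), by push_cast; ring⟩
  · exact ⟨0, by push_cast; ring⟩

end ExplicitMatrices

section QInvariant

open Matrix

theorem abs_det_of_antitriangular {n : ℕ} {M : Matrix (Fin n) (Fin n) ℚ}
    (h : ∀ i j : Fin n, n ≤ i.val + j.val → M i j = 0) : |M.det| = ∏ i, |M i i.rev| := by
  rw [det_of_antitriangular M h, abs_mul, abs_neg_one_pow, one_mul, Finset.abs_prod]

theorem abs_coeff_neg_one_pow_mul (s : ℕ) (p : ℚ[X]) (k : ℕ) :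
    |((-1) ^ s * p).coeff k| = |p.coeff k| := by
  rcases neg_one_pow_eq_or ℚ[X] s with hs | hs <;> simp [hs]

theorem coeff_kernelVector_X_sub_C_of_lt {g : ℕ} (a m : ℚ) {i k : Fin (g + 1)}
    (h : g < i.val + k.val) : (kernelVector g (X - C a) (C m) i).coeff k.val = 0 := by
  rw [kernelVector]
  split_ifs with hi
  · rw [coeff_C_of_ne_zero (by lia)]
  · refine coeff_eq_zero_of_natDegree_lt ?_
    rw [natDegree_pow, natDegree_X_sub_C, mul_one, Fin.val_rev]
    lia

theorem coeff_kernelVector_X_sub_C_rev {g : ℕ} (a m : ℚ) (i : Fin (g + 1)) :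
    (kernelVector g (X - C a) (C m) i).coeff i.rev.val = if i = Fin.last g then m else 1 := by
  rw [kernelVector]
  split_ifs with hi
  · rw [hi, Fin.rev_last, Fin.val_zero, coeff_C_zero]
  · have hmonic := ((monic_X_sub_C a).pow i.rev.val).coeff_natDegree
    rwa [natDegree_pow, natDegree_X_sub_C, mul_one] at hmonic

variable {n g m : ℕ} {B : Matrix (Fin n) (Fin n) ℚ}

theorem HasNormalTopRows.pencil_topRight (hB : HasNormalTopRows g m B) (hn : g + 1 ≤ n) (l : ℚ) :
    (X : ℚ[X]) • (topRight g hn (antiDiag n)).map C - (topRight g hn (B + l • antiDiag n)).map C =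
      pencilBlock g (X - C l) (C (m : ℚ)) := by
  refine Matrix.ext fun i j => ?_
  simp only [topRight, pencilBlock, Matrix.sub_apply, Matrix.smul_apply, Matrix.map_apply,
    Matrix.add_apply, of_apply, antiDiag, Fin.ext_iff, Fin.val_succ, Fin.val_castSucc, Fin.val_rev]
  rw [hB _ _ i.isLt]
  split_ifs <;> first | lia | simp

theorem HasNormalTopRows.signedMinor_topRight (hB : HasNormalTopRows g m B) (hg : g ≠ 0)
    (hn : g + 1 ≤ n) (l : ℚ) (i : Fin (g + 1)) :
    signedMinor (topRight g hn (antiDiag n)) (topRight g hn (B + l • antiDiag n)) i =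
      (-1) ^ (g * (g - 1) / 2) * kernelVector g (X - C l) (C (m : ℚ)) i := by
  rw [signedMinor, hB.pencil_topRight, signed_minor_pencilBlock _ hg (X_sub_C_ne_zero l)]

theorem HasNormalTopRows.abs_matQ_add_smul_antiDiag (hB : HasNormalTopRows g m B) (hg : g ≠ 0)
    (hn : g + 1 ≤ n) (l : ℚ) : |matQ g hn (B + l • antiDiag n)| = m := by
  have habs (i : Fin (g + 1)) (k : ℕ) := congr_arg (fun p => |p.coeff k|)
    (hB.signedMinor_topRight hg hn l i)
  simp only [abs_coeff_neg_one_pow_mul] at habs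
  rw [matQ, pairQ, abs_det_of_antitriangular]
  · simp only [of_apply, habs, coeff_kernelVector_X_sub_C_rev, apply_ite abs, Nat.abs_cast,
      abs_one, Finset.prod_ite_eq', Finset.mem_univ, if_true]
  · intro i k hik
    rw [of_apply, ← abs_eq_zero, habs, coeff_kernelVector_X_sub_C_of_lt _ _ hik, abs_zero]

end QInvariant

section Lifting

theorem invPoly_add_smul_antiDiag_of_comp {n : ℕ} {B : Matrix (Fin n) (Fin n) ℚ} {f F : ℤ[X]}
    {l : ℤ} (hB : invPoly B = F.map (Int.castRingHom ℚ)) (hf : f.comp (X + C l) = F) :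
    invPoly (B + (l : ℚ) • antiDiag n) = f.map (Int.castRingHom ℚ) := by
  rw [invPoly_add_smul_antiDiag, hB, ← hf, Polynomial.map_comp, Polynomial.comp_assoc]
  simp

theorem exists_section {n g m d : ℕ} (hg : 1 ≤ g) (hgn : g + 1 < n) (hm : Squarefree m)
    (hd : ∀ p : ℕ, p.Prime → p ∣ d → p = 2) {B : (ℕ → ℤ) → Matrix (Fin n) (Fin n) ℚ}
    (hBmem : ∀ c, B c ∈ W0Lattice g n d) (hBtop : ∀ c, HasNormalTopRows g m (B c))
    (hB : ∀ c, invPoly (B c) = (normalForm n m c).map (Int.castRingHom ℚ)) :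
    ∃ σ : weakSet n m → W0Lattice g n d, ∀ f : weakSet n m,
      (∃ (l : ℤ) (c : ℕ → ℤ), (f : ℤ[X]).comp (X + C l) = normalForm n m c ∧
        (σ f : Matrix (Fin n) (Fin n) ℚ) = B c + (l : ℚ) • antiDiag n) ∧
      invPoly (σ f : Matrix (Fin n) (Fin n) ℚ) = (f : ℤ[X]).map (Int.castRingHom ℚ) ∧
      (∀ p : ℕ, p.Prime → p ∣ m →
        StronglyDvdMatDisc (W0Lattice g n d) p (σ f : Matrix (Fin n) (Fin n) ℚ)) ∧
      |matQ g hgn.le (σ f : Matrix (Fin n) (Fin n) ℚ)| = (m : ℚ) := by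
  choose l c hlc using fun f : weakSet n m => exists_comp_eq_normalForm hm (by lia) f.2
  refine ⟨fun f => ⟨B (c f) + (l f : ℚ) • antiDiag n, add_mem_W0Lattice (hBmem _)
    (smul_antiDiag_mem_W0Lattice g n d (l f))⟩, fun f => ⟨⟨l f, c f, hlc f, rfl⟩,
      invPoly_add_smul_antiDiag_of_comp (hB _) (hlc f), fun p hp hpm => ?_,
      (hBtop _).abs_matQ_add_smul_antiDiag (by lia) hgn.le _⟩⟩
  have : Fact p.Prime := ⟨hp⟩
  have hp2 : p ≠ 2 := (f.2.2.2 p hp hpm).ne_two f.2.1 (by rw [f.2.2.1]; lia)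
  refine stronglyDvdMatDisc (hp2 ∘ hd p hp) (hBmem _) (r := ⟨0, by lia⟩) hg (by lia)
    (fun j => ?_) (l f)
  obtain ⟨q, rfl⟩ := hpm
  rw [hBtop _ ⟨0, by lia⟩ j hg, zero_add, if_pos rfl]
  exact ⟨if j.val + 2 = n then q else 0, by split_ifs <;> simp⟩

end Lifting

end SquarefreeDisc

end

theorem mainTheorem8 (g : ℕ) (hg : 1 ≤ g) (m : ℕ) (hm : Squarefree m) :
    (∃ σ : ↥(SquarefreeDisc.weakSet (2 * g + 1) m) →
        ↥(SquarefreeDisc.W0Lattice g (2 * g + 1) 2),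
      ∀ f : ↥(SquarefreeDisc.weakSet (2 * g + 1) m),
        (∃ (l : ℤ) (c : ℕ → ℤ),
          (f : Polynomial ℤ).comp (Polynomial.X + Polynomial.C l) =
              SquarefreeDisc.normalForm (2 * g + 1) m c ∧
            (σ f : Matrix (Fin (2 * g + 1)) (Fin (2 * g + 1)) ℚ) =
              SquarefreeDisc.oddMatrix g m c + (l : ℚ) • SquarefreeDisc.antiDiag (2 * g + 1)) ∧
        SquarefreeDisc.invPoly (σ f : Matrix (Fin (2 * g + 1)) (Fin (2 * g + 1)) ℚ) =
          (f : Polynomial ℤ).map (Int.castRingHom ℚ) ∧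
        (∀ p : ℕ, p.Prime → p ∣ m →
          SquarefreeDisc.StronglyDvdMatDisc (SquarefreeDisc.W0Lattice g (2 * g + 1) 2) p
            (σ f : Matrix (Fin (2 * g + 1)) (Fin (2 * g + 1)) ℚ)) ∧
        |SquarefreeDisc.matQ g (by omega)
          (σ f : Matrix (Fin (2 * g + 1)) (Fin (2 * g + 1)) ℚ)| = (m : ℚ)) ∧
    (∃ σ : ↥(SquarefreeDisc.weakSet (2 * g + 2) m) →
        ↥(SquarefreeDisc.W0Lattice g (2 * g + 2) 4),
      ∀ f : ↥(SquarefreeDisc.weakSet (2 * g + 2) m),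
        (∃ (l : ℤ) (c : ℕ → ℤ),
          (f : Polynomial ℤ).comp (Polynomial.X + Polynomial.C l) =
              SquarefreeDisc.normalForm (2 * g + 2) m c ∧
            (σ f : Matrix (Fin (2 * g + 2)) (Fin (2 * g + 2)) ℚ) =
              SquarefreeDisc.evenMatrix g m c + (l : ℚ) • SquarefreeDisc.antiDiag (2 * g + 2)) ∧
        SquarefreeDisc.invPoly (σ f : Matrix (Fin (2 * g + 2)) (Fin (2 * g + 2)) ℚ) =
          (f : Polynomial ℤ).map (Int.castRingHom ℚ) ∧
        (∀ p : ℕ, p.Prime → p ∣ m →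
          SquarefreeDisc.StronglyDvdMatDisc (SquarefreeDisc.W0Lattice g (2 * g + 2) 4) p
            (σ f : Matrix (Fin (2 * g + 2)) (Fin (2 * g + 2)) ℚ)) ∧
        |SquarefreeDisc.matQ g (by omega)
          (σ f : Matrix (Fin (2 * g + 2)) (Fin (2 * g + 2)) ℚ)| = (m : ℚ)) := by
  have hd₂ (p : ℕ) (hp : p.Prime) (hpd : p ∣ 2) : p = 2 :=
    (Nat.prime_dvd_prime_iff_eq hp Nat.prime_two).1 hpd
  have hd₄ (p : ℕ) (hp : p.Prime) (hpd : p ∣ 4) : p = 2 :=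
    hd₂ p hp (hp.dvd_of_dvd_pow (n := 2) hpd)
  exact ⟨SquarefreeDisc.exists_section hg (by lia) hm hd₂
      (SquarefreeDisc.oddMatrix_mem_W0Lattice g m)
      (SquarefreeDisc.hasNormalTopRows_oddMatrix g m)
      (fun c => SquarefreeDisc.invPoly_oddMatrix m c hg),
    SquarefreeDisc.exists_section hg (by lia) hm hd₄
      (SquarefreeDisc.evenMatrix_mem_W0Lattice g m)
      (SquarefreeDisc.hasNormalTopRows_evenMatrix g m)
      (fun c => SquarefreeDisc.invPoly_evenMatrix m c hg)⟩
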